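/- A translation surface is a triple $(S,\Sigma,\omega)$ where $S$ is a compact connected oriented surface without boundary, $\Sigma\subset S$ is a finite set, whose elements are called singularities, and $\omega$ is an atlas of charts $S\setminus\Sigma\supset U_i\to\mathbb{R}^2=\mathbb{C}$ covering $S\setminus\Sigma$ whose changes of charts are locally translations, such that each $P\in\Sigma$ has a neighbourhood on which, away from $P$, the structure is pulled back from the punctured plane by a connected covering of finite degree $k+1\ge 1$ (so $P$ is a cone point of angle $2\pi(k+1)$; the case $k=0$ of a marked point is allowed). For $\theta\in\mathbb{S}^1$, the directional flow $\mathcal F_\theta$ moves points of $S\setminus\Sigma$ at unit speed in the direction $\theta$ in the charts, as long as they do not run into $\Sigma$. The leaf of $x\in S\setminus\Sigma$ is its full (forward and backward) orbit in $S\setminus\Sigma$, and a saddle connection of $\mathcal F_\theta$ is a leaf of finite length whose two ends converge to points of $\Sigma$, possibly equal. Proposition. Let $(S,\Sigma,\omega)$ be a translation surface with $\Sigma\neq\emptyset$ (which is automatic if $S$ has genus at least $2$), and let $\theta\in\mathbb{S}^1$. If the directional flow $\mathcal F_\theta$ has no saddle connection, then it is minimal: every leaf of $\mathcal F_\theta$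 is dense in $S$. -/

import Mathlib

open Set Filter Topology

/-- A translation structure on a compact connected Hausdorff space `S`: a finite set `sing` of
singularities (cone angles `2π(k+1)`, where `k = 0`, i.e. a marked point, is allowed) together with
a translation atlas on its complement.
The charts `φ` of `cone` and the charts of `atlas` cover `S`, so `S` is a topological surface without
boundary, and it is oriented by these charts. -/
structure TranslationSurface (S : Type*) [TopologicalSpace S] [T2Space S] [CompactSpace S]
    [ConnectedSpace S] where
  /-- The set `Σ` of singularities. -/
  sing : Set S
  finite_sing : sing.Finite
  /-- The charts of the translation atlas, as local homeomorphisms from `S` to the plane. -/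
  atlas : Set (OpenPartialHomeomorph S ℂ)
  /-- The charts are charts of `S ∖ Σ`. -/
  disjoint_sing : ∀ e ∈ atlas, Disjoint e.source sing
  /-- The charts cover `S ∖ Σ`. -/
  exists_chart : ∀ x, x ∉ sing → ∃ e ∈ atlas, x ∈ e.source
  /-- Changes of charts are (locally) translations. -/
  compatible : ∀ e ∈ atlas, ∀ e' ∈ atlas, ∀ x ∈ e.source ∩ e'.source,
    ∃ c : ℂ, ∀ᶠ y in 𝓝 x, e y = e' y + c
  /-- Near a singularity `P` the translation structure is the one pulled back from the punctured
  plane by a connected covering with `k + 1` sheets: in a suitable coordinate `φ` onto a disc, with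
  `φ P = 0`, this covering is `w ↦ w ^ (k + 1)`. -/
  cone : ∀ P ∈ sing, ∃ (k : ℕ) (r : ℝ) (φ : OpenPartialHomeomorph S ℂ),
    0 < r ∧ φ.target = Metric.ball 0 r ∧ P ∈ φ.source ∧ φ P = 0 ∧ φ.source ∩ sing = {P} ∧
    ∀ e ∈ atlas, ∀ x ∈ φ.source ∩ e.source,
      ∃ c : ℂ, ∀ᶠ y in 𝓝 x, φ y ^ (k + 1) = e y + c

namespace TranslationSurface

variable {S : Type*} [TopologicalSpace S] [T2Space S] [CompactSpace S] [ConnectedSpace S]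

/-- On the set of times `J`, the curve `γ` stays in `S ∖ Σ` and is an orbit of the directional flow:
read in the translation charts, it moves at unit speed in the direction `θ`. -/
def IsTrajectoryOn (M : TranslationSurface S) (θ : Circle) (γ : ℝ → S) (J : Set ℝ) : Prop :=
  ∀ t ∈ J, ∃ e ∈ M.atlas, γ t ∈ e.source ∧
    ∀ᶠ s in 𝓝[J] t, γ s ∈ e.source ∧ e (γ s) = e (γ t) + ((s - t : ℝ) : ℂ) * (θ : ℂ)

/-- The (partially defined) directional flow `F_θ`: the orbit of `x` in direction `θ` is defined
from time `0` to time `t` and is at `y` at time `t` (`t` may be negative). -/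
def FlowsTo (M : TranslationSurface S) (θ : Circle) (t : ℝ) (x y : S) : Prop :=
  ∃ γ : ℝ → S, M.IsTrajectoryOn θ γ (uIcc 0 t) ∧ γ 0 = x ∧ γ t = y

/-- The leaf of `F_θ` through `x`: all the points reached from `x`, forwards or backwards, before
the orbit possibly runs into a singularity. -/
def leaf (M : TranslationSurface S) (θ : Circle) (x : S) : Set S :=
  {y | ∃ t : ℝ, M.FlowsTo θ t x y}

/-- There is a saddle connection in direction `θ`: a leaf of finite length joining two (possibly
equal) singularities. -/
def HasSaddleConnection (M : TranslationSurface S) (θ : Circle) : Prop :=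
  ∃ (L : ℝ) (γ : ℝ → S), 0 < L ∧ ContinuousOn γ (Icc 0 L) ∧ γ 0 ∈ M.sing ∧ γ L ∈ M.sing ∧
    M.IsTrajectoryOn θ γ (Ioo 0 L)

/-- `F_θ` is minimal: all its leaves are dense in `S`. -/
def IsMinimalFlow (M : TranslationSurface S) (θ : Circle) : Prop :=
  ∀ x, x ∉ M.sing → Dense (M.leaf θ x)

end TranslationSurface

/-! ### Local translations and straight trajectories -/

namespace TranslationSurface

/-! Let `K` be the closure of a leaf. It is invariant under the flow, and the regular part of the
surface is connected (`isPreconnected_compl_sing`), so it suffices that every regular point of `K`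
is interior to `K`. If one is not, a short transversal carries a point of `K` that is an endpoint of
a gap, an interval missing `K` (`exists_gap`). Without saddle connections, the leaf of that endpoint
is infinite in at least one direction (`hasSaddleConnection_of_not_surv`).

Push the gap along this infinite half-leaf. If no narrow strip survived forever, infinitely many
heights of the gap would run into singularities, each at a time up to which all lower heights
survive. A cone point receives only finitely many separatrices (`exists_ne_meet`), so two such
heights would lie on the same trajectory, and the flow would carry the endpoint into its own gap.
Hence an infinite strip exists (`exists_infinite_strip`). By compactness its edge accumulates at a
regular point; two close returns force the leaf of the endpoint to be periodic, since the strip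
cannot meet `K` (`exists_periodic_of_strip`).

A periodic leaf is impossible too. Without saddle connections, the regular points of a given period
form an open and closed subset of the regular part, hence all of it, whereas some trajectory runs
into each singularity (`exists_not_surv`, `hasSaddleConnection_of_periodic`). -/

theorem eventually_add_mem_target {S : Type*} [TopologicalSpace S]
    {e : OpenPartialHomeomorph S ℂ} {x : S} (hx : x ∈ e.source) :
    ∀ᶠ z in 𝓝 (0 : ℂ), e x + z ∈ e.target := by
  have : Tendsto (fun z : ℂ => e x + z) (𝓝 0) (𝓝 (e x)) := by
    simpa using (continuous_const_add (e x)).tendsto 0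
  exact this (e.open_target.mem_nhds (e.map_source hx))

theorem tendsto_symm_add {S : Type*} [TopologicalSpace S]
    {e : OpenPartialHomeomorph S ℂ} {x : S} (hx : x ∈ e.source) :
    Tendsto (fun z : ℂ => e.symm (e x + z)) (𝓝 0) (𝓝 x) := by
  have h1 : Tendsto (fun z : ℂ => e x + z) (𝓝 0) (𝓝 (e x)) := by
    simpa using (continuous_const_add (e x)).tendsto 0
  have h2 := (e.continuousAt_symm (e.map_source hx)).tendsto
  rw [e.left_inv hx] at h2
  exact h2.comp h1

variable {S : Type*} [TopologicalSpace S] [T2Space S] [CompactSpace S] [ConnectedSpace S]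

open Classical in
/-- The point `x + z`, computed in a fixed translation chart around the regular point `x`.
It is meaningful for small `z`. -/
noncomputable def tr (M : TranslationSurface S) (x : S) (z : ℂ) : S :=
  if h : x ∉ M.sing then
    (M.exists_chart x h).choose.symm ((M.exists_chart x h).choose x + z) else x

theorem notMem_sing (M : TranslationSurface S) {e : OpenPartialHomeomorph S ℂ} (he : e ∈ M.atlas)
    {x : S} (hx : x ∈ e.source) : x ∉ M.sing :=
  disjoint_left.1 (M.disjoint_sing e he) hx

theorem isOpen_compl_sing (M : TranslationSurface S) : IsOpen M.singᶜ :=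
  M.finite_sing.isClosed.isOpen_compl

theorem exists_tr_eq (M : TranslationSurface S) {x : S} (hx : x ∉ M.sing) :
    ∃ e ∈ M.atlas, x ∈ e.source ∧ ∀ z, M.tr x z = e.symm (e x + z) := by
  refine ⟨_, (M.exists_chart x hx).choose_spec.1, (M.exists_chart x hx).choose_spec.2, fun z => ?_⟩
  rw [tr, dif_pos hx]

/-- `tr` can be computed in any chart. -/
theorem tr_eventuallyEq (M : TranslationSurface S) {e : OpenPartialHomeomorph S ℂ}
    (he : e ∈ M.atlas) {x : S} (hx : x ∈ e.source) :
    ∀ᶠ z in 𝓝 (0 : ℂ), M.tr x z = e.symm (e x + z) := by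
  obtain ⟨e', he', hx', htr⟩ := M.exists_tr_eq (M.notMem_sing he hx)
  obtain ⟨c, hc⟩ := M.compatible e he e' he' x ⟨hx, hx'⟩
  have hlim := tendsto_symm_add (e := e') hx'
  filter_upwards [hlim hc, hlim (e.open_source.mem_nhds hx), eventually_add_mem_target hx']
    with z h1 h2 h3
  have h0 := hc.self_of_nhds
  simp only [mem_preimage, mem_ofPred_eq] at h1 h2
  rw [e'.right_inv h3] at h1
  rw [htr, ← e.left_inv h2, h1, h0]
  congr 1; ring

@[simp] theorem tr_zero (M : TranslationSurface S) (x : S) : M.tr x 0 = x := by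
  by_cases hx : x ∈ M.sing
  · simp [tr, hx]
  · obtain ⟨e, he, hxe, h⟩ := M.exists_tr_eq hx
    rw [h, add_zero, e.left_inv hxe]

/-- Lets every local statement at a regular point be read in the plane near `0`, with no further
mention of charts. -/
theorem map_tr (M : TranslationSurface S) {x : S} (hx : x ∉ M.sing) :
    map (M.tr x) (𝓝 0) = 𝓝 x := by
  obtain ⟨e, he, hxe, h⟩ := M.exists_tr_eq hx
  have h1 : M.tr x = e.symm ∘ fun z => e x + z := funext h
  have h2 : map (fun z => e x + z) (𝓝 0) = 𝓝 (e x) := by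
    simp
  rw [h1, ← Filter.map_map, h2, e.symm_map_nhds_eq hxe]

theorem tendsto_tr (M : TranslationSurface S) {x : S} (hx : x ∉ M.sing) :
    Tendsto (M.tr x) (𝓝 0) (𝓝 x) := (M.map_tr hx).le

theorem eventually_nhds_iff (M : TranslationSurface S) {x : S} (hx : x ∉ M.sing) {p : S → Prop} :
    (∀ᶠ y in 𝓝 x, p y) ↔ ∀ᶠ z in 𝓝 0, p (M.tr x z) := by
  rw [← M.map_tr hx, eventually_map]

theorem frequently_nhds_iff (M : TranslationSurface S) {x : S} (hx : x ∉ M.sing) {p : S → Prop} :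
    (∃ᶠ y in 𝓝 x, p y) ↔ ∃ᶠ z in 𝓝 0, p (M.tr x z) := by
  rw [← M.map_tr hx, frequently_map]

/-- The plane disc of radius `ε` develops around `x` by translations. -/
def IsGoodRadius (M : TranslationSurface S) (x : S) (ε : ℝ) : Prop :=
  0 < ε ∧ ∀ z : ℂ, ‖z‖ < ε → M.tr x z ∉ M.sing ∧ ∀ᶠ z' in 𝓝 0, M.tr (M.tr x z) z' = M.tr x (z + z')

theorem exists_isGoodRadius (M : TranslationSurface S) {x : S} (hx : x ∉ M.sing) :
    ∃ ε, M.IsGoodRadius x ε := by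
  obtain ⟨e, he, hxe, h⟩ := M.exists_tr_eq hx
  obtain ⟨ε, hε, hball⟩ := Metric.eventually_nhds_iff.1 (eventually_add_mem_target hxe)
  refine ⟨ε, hε, fun z hz => ?_⟩
  have hz' : e x + z ∈ e.target := hball (by simpa using hz)
  have hs : M.tr x z ∈ e.source := by rw [h]; exact e.map_target hz'
  refine ⟨M.notMem_sing he hs, ?_⟩
  filter_upwards [M.tr_eventuallyEq he hs] with z' hz1
  rw [hz1, h, h, e.right_inv hz', add_assoc]

/-- `γ` is on `J` a straight curve with velocity `w` in the translation charts. -/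
def Traj (M : TranslationSurface S) (w : ℂ) (γ : ℝ → S) (J : Set ℝ) : Prop :=
  ∀ t ∈ J, γ t ∉ M.sing ∧ ∀ᶠ s in 𝓝[J] t, γ s = M.tr (γ t) (((s - t : ℝ) : ℂ) * w)

theorem tendsto_sub_mul (w : ℂ) (t : ℝ) (J : Set ℝ) :
    Tendsto (fun s : ℝ => ((s - t : ℝ) : ℂ) * w) (𝓝[J] t) (𝓝 0) := by
  have : Continuous fun s : ℝ => ((s - t : ℝ) : ℂ) * w := by fun_prop
  simpa using (this.tendsto t).mono_left nhdsWithin_le_nhds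

theorem isTrajectoryOn_iff (M : TranslationSurface S) (θ : Circle) (γ : ℝ → S) (J : Set ℝ) :
    M.IsTrajectoryOn θ γ J ↔ M.Traj θ γ J := by
  refine forall₂_congr fun t ht => ⟨?_, ?_⟩
  · rintro ⟨e, he, hte, hs⟩
    refine ⟨M.notMem_sing he hte, ?_⟩
    filter_upwards [hs, tendsto_sub_mul θ t J (M.tr_eventuallyEq he hte)] with s h1 h2
    rw [h2, ← h1.2, e.left_inv h1.1]
  · rintro ⟨hs, h⟩
    obtain ⟨e, he, hte, htr⟩ := M.exists_tr_eq hs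
    refine ⟨e, he, hte, ?_⟩
    filter_upwards [h, tendsto_sub_mul θ t J (eventually_add_mem_target hte)] with s h1 h2
    rw [h1, htr]
    exact ⟨e.map_target h2, e.right_inv h2⟩

namespace Traj

variable {M : TranslationSurface S} {w : ℂ} {γ γ' : ℝ → S} {J J' : Set ℝ}

theorem mono (h : M.Traj w γ J) (hJ : J' ⊆ J) : M.Traj w γ J' := fun t ht =>
  ⟨(h t (hJ ht)).1, (h t (hJ ht)).2.filter_mono (nhdsWithin_mono t hJ)⟩

theorem congr (h : M.Traj w γ J) (hJ : EqOn γ γ' J) : M.Traj w γ' J := fun t ht => by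
  rw [← hJ ht]
  refine ⟨(h t ht).1, ?_⟩
  filter_upwards [(h t ht).2, self_mem_nhdsWithin] with s hs hsJ
  rw [← hJ hsJ, hs]

theorem continuousOn (h : M.Traj w γ J) : ContinuousOn γ J := fun t ht => by
  have := (M.tendsto_tr (h t ht).1).comp (tendsto_sub_mul w t J)
  exact this.congr' ((h t ht).2.mono fun s hs => hs.symm)

/-- Agreement propagates locally because both curves follow the same `M.tr`; disagreement does
because `S` is Hausdorff. Connectedness of `J` concludes. -/
theorem eqOn (h : M.Traj w γ J) (h' : M.Traj w γ' J) (hJ : IsPreconnected J) {t₀ : ℝ}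
    (ht₀ : t₀ ∈ J) (h0 : γ t₀ = γ' t₀) : EqOn γ γ' J := by
  intro t ht
  refine (hJ.induction₂ (fun a b => γ a = γ' a ↔ γ b = γ' b) ?_ ?_ ?_ ht₀ ht).1 h0
  · intro a ha
    by_cases hEq : γ a = γ' a
    · filter_upwards [(h a ha).2, (h' a ha).2] with s h1 h2
      simp [h1, h2, hEq]
    · obtain ⟨U, V, hU, hV, haU, haV, hUV⟩ := _root_.t2_separation hEq
      filter_upwards [h.continuousOn a ha (hU.mem_nhds haU),
        h'.continuousOn a ha (hV.mem_nhds haV)] with s h1 h2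
      refine iff_of_false hEq fun h3 => disjoint_left.1 hUV h1 ?_
      rw [h3]; exact h2
  · intro a b c _ _ _ h1 h2; exact h1.trans h2
  · intro a b _ _ h1; exact h1.symm

theorem comp_affine (h : M.Traj w γ J) (a b : ℝ) :
    M.Traj (a * w) (fun t => γ (a * t + b)) ((fun t => a * t + b) ⁻¹' J) := fun t ht => by
  refine ⟨(h _ ht).1, ?_⟩
  have : Tendsto (fun t => a * t + b) (𝓝[(fun t => a * t + b) ⁻¹' J] t) (𝓝[J] (a * t + b)) :=
    tendsto_nhdsWithin_iff.2 ⟨((by fun_prop : Continuous fun t => a * t + b).tendsto t).mono_left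
      nhdsWithin_le_nhds, self_mem_nhdsWithin⟩
  filter_upwards [this (h _ ht).2] with s hs
  rw [mem_preimage, mem_ofPred_eq] at hs
  rw [hs]; congr 1; push_cast; ring

/-- Trajectories on two intervals with a common point glue. -/
theorem glue (h : M.Traj w γ J) (h' : M.Traj w γ' J') (hJ : OrdConnected J) (hJ' : OrdConnected J')
    {t₀ : ℝ} (ht₀ : t₀ ∈ J) (ht₀' : t₀ ∈ J') (h0 : γ t₀ = γ' t₀) :
    ∃ η, M.Traj w η (J ∪ J') ∧ EqOn η γ J ∧ EqOn η γ' J' := by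
  classical
  have hEq : EqOn γ γ' (J ∩ J') :=
    (h.mono inter_subset_left).eqOn (h'.mono inter_subset_right)
      (hJ.inter hJ').isPreconnected ⟨ht₀, ht₀'⟩ h0
  -- At a boundary time belonging to only one interval, nearby times of the other lie between it and
  -- `t₀`, hence in both.
  have key : ∀ (A B : Set ℝ), OrdConnected A → OrdConnected B → t₀ ∈ A → t₀ ∈ B →
      ∀ t ∈ A, t ∉ B → ∀ᶠ s in 𝓝[B] t, s ∈ A := by
    intro A B hA hB h1 h2 t ht htB
    rcases lt_trichotomy t t₀ with hlt | rfl | hlt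
    · filter_upwards [self_mem_nhdsWithin, nhdsWithin_le_nhds (Iio_mem_nhds hlt)] with s hsB hs
      have : t ≤ s := by
        by_contra hcon
        exact htB (hB.out hsB h2 ⟨(not_le.1 hcon).le, hlt.le⟩)
      exact hA.out ht h1 ⟨this, hs.le⟩
    · exact absurd h2 htB
    · filter_upwards [self_mem_nhdsWithin, nhdsWithin_le_nhds (Ioi_mem_nhds hlt)] with s hsB hs
      have : s ≤ t := by
        by_contra hcon
        exact htB (hB.out h2 hsB ⟨hlt.le, (not_le.1 hcon).le⟩)
      exact hA.out h1 ht ⟨hs.le, this⟩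
  let η : ℝ → S := fun t => if t ∈ J then γ t else γ' t
  have e1 : EqOn η γ J := fun t ht => if_pos ht
  have e2 : EqOn η γ' J' := fun t ht => by
    by_cases htJ : t ∈ J
    · rw [e1 htJ]; exact hEq ⟨htJ, ht⟩
    · exact if_neg htJ
  refine ⟨η, ?_, e1, e2⟩
  have g1 := h.congr e1.symm
  have g2 := h'.congr e2.symm
  intro t ht
  have hns : η t ∉ M.sing := ht.elim (fun h => (g1 t h).1) (fun h => (g2 t h).1)
  refine ⟨hns, ?_⟩
  rw [nhdsWithin_union]
  by_cases htJ : t ∈ J <;> by_cases htJ' : t ∈ J'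
  · exact eventually_sup.2 ⟨(g1 t htJ).2, (g2 t htJ').2⟩
  · refine eventually_sup.2 ⟨(g1 t htJ).2, ?_⟩
    have := key J J' hJ hJ' ht₀ ht₀' t htJ htJ'
    exact (tendsto_nhdsWithin_iff.2 ⟨tendsto_id.mono_left nhdsWithin_le_nhds, this⟩ :
      Tendsto id (𝓝[J'] t) (𝓝[J] t)) (g1 t htJ).2
  · refine eventually_sup.2 ⟨?_, (g2 t htJ').2⟩
    have := key J' J hJ' hJ ht₀' ht₀ t htJ' htJ
    exact (tendsto_nhdsWithin_iff.2 ⟨tendsto_id.mono_left nhdsWithin_le_nhds, this⟩ :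
      Tendsto id (𝓝[J] t) (𝓝[J'] t)) (g2 t htJ').2
  · exact absurd ht (by simp [htJ, htJ'])

end Traj

/-- Straight segments in a good disc are trajectories. -/
theorem IsGoodRadius.traj {M : TranslationSurface S} {x : S} {ε : ℝ} (h : M.IsGoodRadius x ε)
    (z w : ℂ) {J : Set ℝ} (hJ : ∀ t ∈ J, ‖z + t * w‖ < ε) :
    M.Traj w (fun t => M.tr x (z + t * w)) J := fun t ht => by
  refine ⟨(h.2 _ (hJ t ht)).1, ?_⟩
  filter_upwards [tendsto_sub_mul w t J (h.2 _ (hJ t ht)).2] with s hs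
  rw [mem_preimage, mem_ofPred_eq] at hs
  rw [hs]; congr 1; push_cast; ring

end TranslationSurface

/-! ### The partially defined straight flow and survival times -/

namespace TranslationSurface

variable {S : Type*} [TopologicalSpace S] [T2Space S] [CompactSpace S] [ConnectedSpace S]

/-- The straight flow with velocity `w` is defined at `x` up to time `t` and brings `x` to `y`. -/
def Flow (M : TranslationSurface S) (w : ℂ) (t : ℝ) (x y : S) : Prop :=
  ∃ γ : ℝ → S, M.Traj w γ (uIcc 0 t) ∧ γ 0 = x ∧ γ t = y

theorem flowsTo_iff (M : TranslationSurface S) (θ : Circle) (t : ℝ) (x y : S) :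
    M.FlowsTo θ t x y ↔ M.Flow θ t x y := by
  simp only [FlowsTo, Flow, isTrajectoryOn_iff]

variable {M : TranslationSurface S} {w : ℂ} {γ : ℝ → S} {J : Set ℝ}

theorem Traj.flow (h : M.Traj w γ J) (hJ : OrdConnected J) {a b : ℝ} (ha : a ∈ J) (hb : b ∈ J) :
    M.Flow w (b - a) (γ a) (γ b) := by
  refine ⟨fun t => γ (1 * t + a), ?_, by simp, by simp⟩
  have := h.comp_affine 1 a
  rw [Complex.ofReal_one, one_mul] at this
  refine this.mono fun t ht => ?_
  rw [mem_preimage]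
  refine hJ.uIcc_subset ha hb ?_
  rw [mem_uIcc] at ht ⊢
  rcases ht with h | h
  · left; constructor <;> linarith
  · right; constructor <;> linarith

theorem Traj.flow_zero (h : M.Traj w γ J) (hJ : OrdConnected J) {t : ℝ} (h0 : (0 : ℝ) ∈ J)
    (ht : t ∈ J) : M.Flow w t (γ 0) (γ t) := by
  simpa using h.flow hJ h0 ht

theorem IsGoodRadius.flow {x : S} {ε : ℝ} (h : M.IsGoodRadius x ε) {z : ℂ} {a : ℝ}
    (ha : ‖z‖ + |a| * ‖w‖ < ε) : M.Flow w a (M.tr x z) (M.tr x (z + a * w)) := by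
  have htr := h.traj z w (J := uIcc 0 a) fun r hr => by
    have h1 : |r| ≤ |a| := by simpa using abs_sub_left_of_mem_uIcc hr
    have h2 : ‖(r : ℂ) * w‖ ≤ |a| * ‖w‖ := by
      rw [norm_mul, Complex.norm_real]
      exact mul_le_mul_of_nonneg_right h1 (norm_nonneg _)
    linarith [norm_add_le z (r * w)]
  simpa using htr.flow_zero ordConnected_uIcc left_mem_uIcc right_mem_uIcc

namespace Flow

variable {t s a : ℝ} {x y z y' : S}

theorem left_notMem (h : M.Flow w t x y) : x ∉ M.sing := by
  obtain ⟨γ, h, rfl, -⟩ := h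
  exact (h 0 left_mem_uIcc).1

theorem right_notMem (h : M.Flow w t x y) : y ∉ M.sing := by
  obtain ⟨γ, h, -, rfl⟩ := h
  exact (h t right_mem_uIcc).1

theorem refl (hx : x ∉ M.sing) : M.Flow w 0 x x :=
  ⟨fun _ => x, fun t ht => ⟨hx, by
    simp only [uIcc_self, mem_singleton_iff] at ht
    subst ht
    rw [uIcc_self]
    filter_upwards [self_mem_nhdsWithin] with s hs
    simp [mem_singleton_iff.1 hs]⟩, rfl, rfl⟩

theorem unique (h : M.Flow w t x y) (h' : M.Flow w t x y') : y = y' := by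
  obtain ⟨γ, h, rfl, rfl⟩ := h
  obtain ⟨γ', h', h0, rfl⟩ := h'
  exact h.eqOn h' isPreconnected_uIcc left_mem_uIcc h0.symm right_mem_uIcc

theorem symm (h : M.Flow w t x y) : M.Flow w (-t) y x := by
  obtain ⟨γ, h, rfl, rfl⟩ := h
  simpa using h.flow ordConnected_uIcc right_mem_uIcc left_mem_uIcc

/-- Reparametrisation of time. Negative `a` is allowed, so that backward orbits are treated as
forward orbits of `-w`. -/
theorem smul (h : M.Flow (a * w) t x y) : M.Flow w (a * t) x y := by
  rcases eq_or_ne a 0 with rfl | ha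
  · obtain ⟨γ, h, rfl, rfl⟩ := h
    have h1 : M.Traj (((0 : ℝ) : ℂ) * w) (fun _ => γ 0) (uIcc 0 t) := fun s hs =>
      ⟨(h 0 left_mem_uIcc).1, by simp⟩
    have := h.eqOn h1 isPreconnected_uIcc left_mem_uIcc rfl right_mem_uIcc
    rw [this, zero_mul]
    exact refl (h 0 left_mem_uIcc).1
  · obtain ⟨γ, h, rfl, rfl⟩ := h
    have h1 := h.comp_affine a⁻¹ 0
    have h2 : ((a⁻¹ : ℝ) : ℂ) * (a * w) = w := by
      rw [← mul_assoc, ← Complex.ofReal_mul, inv_mul_cancel₀ ha]; simp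
    rw [h2] at h1
    have h3 : (0 : ℝ) ∈ (fun t => a⁻¹ * t + 0) ⁻¹' uIcc 0 t := by simp
    have h4 : a * t ∈ (fun t => a⁻¹ * t + 0) ⁻¹' uIcc 0 t := by
      simp [inv_mul_cancel_left₀ ha]
    have hc : OrdConnected ((fun t => a⁻¹ * t + 0) ⁻¹' uIcc 0 t) := by
      rcases lt_or_gt_of_ne (inv_ne_zero ha) with hn | hp
      · refine ordConnected_uIcc.preimage_anti fun p q hpq => ?_
        simpa using mul_le_mul_of_nonpos_left hpq hn.le
      · refine ordConnected_uIcc.preimage_mono fun p q hpq => ?_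
        simpa using mul_le_mul_of_nonneg_left hpq hp.le
    simpa [inv_mul_cancel_left₀ ha] using h1.flow_zero hc h3 h4

theorem neg (h : M.Flow (-w) t x y) : M.Flow w (-t) x y := by
  have := smul (M := M) (w := w) (a := -1) (t := t) (x := x) (y := y) (by simpa using h)
  simpa using this

theorem trans (h : M.Flow w t x y) (h' : M.Flow w s y z) : M.Flow w (t + s) x z := by
  obtain ⟨γ, h, rfl, rfl⟩ := h
  obtain ⟨γ', h', h0, rfl⟩ := h'
  have h2 := h'.comp_affine 1 (-t)
  rw [Complex.ofReal_one, one_mul] at h2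
  have hc : OrdConnected ((fun r => 1 * r + -t) ⁻¹' uIcc 0 s) :=
    ordConnected_uIcc.preimage_mono fun p q hpq => by simpa using hpq
  have ht : t ∈ (fun r => 1 * r + -t) ⁻¹' uIcc 0 s := by simp
  have hs : t + s ∈ (fun r => 1 * r + -t) ⁻¹' uIcc 0 s := by
    rw [mem_preimage, one_mul, add_neg_cancel_comm]; exact right_mem_uIcc
  obtain ⟨η, hη, e1, e2⟩ := h.glue h2 ordConnected_uIcc hc right_mem_uIcc ht (by simp [h0])
  have hsub : uIcc 0 (t + s) ⊆ uIcc 0 t ∪ (fun r => 1 * r + -t) ⁻¹' uIcc 0 s := by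
    refine (uIcc_subset_uIcc_union_uIcc (b := t)).trans (union_subset_union_right _ ?_)
    exact hc.uIcc_subset ht hs
  refine ⟨η, hη.mono hsub, e1 left_mem_uIcc, ?_⟩
  rw [e2 hs]; simp

theorem of_right (h : M.Flow w t x z) (h' : M.Flow w s y z) : M.Flow w (t - s) x y := by
  simpa [sub_eq_add_neg] using h.trans h'.symm

/-- The flow commutes locally with translations. -/
theorem eventually_tr (h : M.Flow w t x y) :
    ∀ᶠ z in 𝓝 (0 : ℂ), M.Flow w t (M.tr x z) (M.tr y z) := by
  obtain ⟨γ, h, rfl, rfl⟩ := h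
  -- The property is local in time, symmetric and transitive, so it passes from neighbouring times
  -- to the whole orbit; inside one good disc the two translations add and commute.
  have := isPreconnected_uIcc.induction₂ (s := uIcc 0 t)
    (fun a b => ∀ᶠ z in 𝓝 (0 : ℂ), M.Flow w (b - a) (M.tr (γ a) z) (M.tr (γ b) z))
    ?_ ?_ ?_ left_mem_uIcc right_mem_uIcc
  · simpa using this
  · intro a ha
    obtain ⟨ε, hε⟩ := M.exists_isGoodRadius (h a ha).1
    have hlim := tendsto_sub_mul w a (uIcc 0 t)
    have hball : ∀ᶠ z : ℂ in 𝓝 0, ‖z‖ < ε / 2 := by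
      filter_upwards [Metric.ball_mem_nhds (0 : ℂ) (half_pos hε.1)] with z hz
      simpa using hz
    filter_upwards [(h a ha).2, hlim hball] with s hs hs2
    simp only [mem_preimage, mem_ofPred_eq] at hs2
    filter_upwards [hball, (hε.2 _ (hs2.trans (half_lt_self hε.1))).2] with z hz hz2
    rw [hs, hz2]
    rw [add_comm _ z]
    refine hε.flow ?_
    have : ‖((s - a : ℝ) : ℂ) * w‖ = |s - a| * ‖w‖ := by rw [norm_mul, Complex.norm_real]; rfl
    linarith
  · intro a b c _ _ _ h1 h2
    filter_upwards [h1, h2] with z h1 h2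
    have := h1.trans h2
    rwa [show b - a + (c - b) = c - a by ring] at this
  · intro a b _ _ h1
    filter_upwards [h1] with z h1
    have := h1.symm
    rwa [neg_sub] at this

end Flow

/-- Flowing a straight curve for a fixed time gives a straight curve. -/
theorem Traj.flow_image {v : ℂ} {σ η : ℝ → S} {T : ℝ} (hσ : M.Traj v σ J)
    (h : ∀ s ∈ J, M.Flow w T (σ s) (η s)) : M.Traj v η J := fun s hs => by
  refine ⟨(h s hs).right_notMem, ?_⟩
  filter_upwards [(hσ s hs).2, tendsto_sub_mul v s J (h s hs).eventually_tr, self_mem_nhdsWithin]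
    with r h1 h2 hr
  rw [mem_preimage, mem_ofPred_eq, ← h1] at h2
  exact (h r hr).unique h2

/-- The straight flow with velocity `w` is defined at `x` up to time `T`. -/
def Surv (M : TranslationSurface S) (w : ℂ) (x : S) (T : ℝ) : Prop := ∃ y, M.Flow w T x y

theorem Surv.mono {x : S} {T T' : ℝ} (h : M.Surv w x T) (h0 : 0 ≤ T') (hT : T' ≤ T) :
    M.Surv w x T' := by
  obtain ⟨y, γ, h, rfl, rfl⟩ := h
  refine ⟨γ T', γ, h.mono ?_, rfl, rfl⟩
  rw [uIcc_of_le h0, uIcc_of_le (h0.trans hT)]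
  exact Icc_subset_Icc_right hT

theorem isOpen_surv (M : TranslationSurface S) (w : ℂ) (T : ℝ) : IsOpen {x | M.Surv w x T} := by
  rw [isOpen_iff_mem_nhds]
  rintro x ⟨y, hy⟩
  change ∀ᶠ x' in 𝓝 x, M.Surv w x' T
  rw [M.eventually_nhds_iff hy.left_notMem]
  filter_upwards [hy.eventually_tr] with z hz
  exact ⟨_, hz⟩

/-- The endpoints at the various times fit together: by uniqueness they agree near `T` with one
trajectory running up to a `T'` that bounds the nearby times of `J`. -/
theorem exists_traj_of_surv {x : S} (J : Set ℝ) (h : ∀ T ∈ J, 0 ≤ T ∧ ∃ T' ∈ J, T ≤ T' ∧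
    M.Surv w x T' ∧ ∀ᶠ s in 𝓝[J] T, s ≤ T') (h0 : (0 : ℝ) ∈ J) :
    ∃ γ, M.Traj w γ J ∧ γ 0 = x := by
  have h1 : ∀ T ∈ J, M.Surv w x T := fun T hT => by
    obtain ⟨h0, T', -, hTT', hS, -⟩ := h T hT
    exact hS.mono h0 hTT'
  choose! γ hγ using h1
  refine ⟨γ, fun t ht => ⟨(hγ t ht).right_notMem, ?_⟩, ?_⟩
  · obtain ⟨ht0, T', -, htT', ⟨y, ρ, hρ, rfl, rfl⟩, hev⟩ := h t ht
    have hT' : 0 ≤ T' := ht0.trans htT'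
    rw [uIcc_of_le hT'] at hρ
    have key : ∀ s ∈ J, s ≤ T' → γ s = ρ s := fun s hs hsT =>
      (hγ s hs).unique (hρ.flow_zero ordConnected_Icc ⟨le_rfl, hT'⟩ ⟨(h s hs).1, hsT⟩)
    have h2 := (hρ t ⟨ht0, htT'⟩).2
    have h3 : ∀ᶠ s in 𝓝[J] t, s ∈ Icc 0 T' := by
      filter_upwards [hev, self_mem_nhdsWithin] with s h1 h2 using ⟨(h s h2).1, h1⟩
    have h4 : Tendsto id (𝓝[J] t) (𝓝[Icc 0 T'] t) :=
      tendsto_nhdsWithin_iff.2 ⟨tendsto_id.mono_left nhdsWithin_le_nhds, h3⟩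
    filter_upwards [h4 h2, hev, self_mem_nhdsWithin] with s h5 h6 h7
    rw [key t ht htT', key s h7 h6]
    exact h5
  · exact (hγ 0 h0).unique (Flow.refl (hγ 0 h0).left_notMem)

theorem exists_traj_Ici {x : S} (h : ∀ T, 0 ≤ T → M.Surv w x T) :
    ∃ γ, M.Traj w γ (Ici 0) ∧ γ 0 = x :=
  exists_traj_of_surv _ (fun T (hT : 0 ≤ T) => ⟨hT, T + 1, by simp; linarith, by linarith,
    h _ (by linarith), nhdsWithin_le_nhds (Iic_mem_nhds (by linarith))⟩) self_mem_Ici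

theorem exists_traj_Ico {x : S} {τ : ℝ} (hτ : 0 < τ) (h : ∀ T, 0 ≤ T → T < τ → M.Surv w x T) :
    ∃ γ, M.Traj w γ (Ico 0 τ) ∧ γ 0 = x :=
  exists_traj_of_surv _ (fun T (hT : 0 ≤ T ∧ T < τ) => ⟨hT.1, (T + τ) / 2,
    ⟨by linarith, by linarith⟩, by linarith, h _ (by linarith) (by linarith),
    nhdsWithin_le_nhds (Iic_mem_nhds (by linarith))⟩) ⟨le_rfl, hτ⟩

end TranslationSurface

/-! ### Ends of half-trajectories and conical singularities -/

/-- A curve in a compact space all of whose cluster points lie in a finite set converges. -/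
theorem exists_tendsto_of_mapClusterPt_mem_finite {X : Type*} [TopologicalSpace X] [T2Space X]
    [CompactSpace X] {F : Set X} (hF : F.Finite) {l : Filter ℝ} [l.NeBot] {γ : ℝ → X}
    (hl : ∀ A ∈ l, ∃ J ∈ l, J ⊆ A ∧ IsPreconnected J ∧ ContinuousOn γ J)
    (hcl : ∀ q, MapClusterPt q l γ → q ∈ F) : ∃ P ∈ F, Tendsto γ l (𝓝 P) := by
  obtain ⟨P, -, hP⟩ := isCompact_univ.exists_mapClusterPt (f := l) (u := γ) (by simp)
  refine ⟨P, hcl P hP, fun N hN => ?_⟩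
  obtain ⟨U, hU, hdis⟩ := hF.t2_separation
  obtain ⟨N', hN', hN'o, hPN'⟩ := mem_nhds_iff.1 hN
  have hAo : IsOpen (U P ∩ N') := (hU P).2.inter hN'o
  have hBo : IsOpen (⋃ Q ∈ F \ {P}, U Q) := isOpen_biUnion fun Q _ => (hU Q).2
  have hFW : F ⊆ (U P ∩ N') ∪ ⋃ Q ∈ F \ {P}, U Q := fun Q hQ => by
    by_cases hQP : Q = P
    · subst hQP; exact Or.inl ⟨(hU Q).1, hPN'⟩
    · exact Or.inr (mem_biUnion (x := Q) ⟨hQ, hQP⟩ (hU Q).1)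
  -- By compactness, an escape would produce a cluster point outside `F`. The two open pieces being
  -- disjoint, a connected tail must stay in the one around `P`.
  have hev : ∀ᶠ t in l, γ t ∈ (U P ∩ N') ∪ ⋃ Q ∈ F \ {P}, U Q := by
    by_contra hcon
    rw [not_eventually] at hcon
    obtain ⟨q, hq, hq'⟩ := (hAo.union hBo).isClosed_compl.isCompact.exists_mapClusterPt_of_frequently
      hcon
    exact hq (hFW (hcl q hq'))
  obtain ⟨J, hJ, hJW, hJc, hγ⟩ := hl _ hev
  have hd : Disjoint (U P ∩ N') (⋃ Q ∈ F \ {P}, U Q) := by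
    rw [disjoint_iUnion₂_right]
    intro Q hQ
    exact (hdis (hcl P hP) hQ.1 (Ne.symm hQ.2)).mono_left inter_subset_left
  have hfr := hP.frequently (hAo.mem_nhds ⟨(hU P).1, hPN'⟩)
  obtain ⟨t, ht, htJ⟩ := (hfr.and_eventually hJ).exists
  have hsub := (hJc.image γ hγ).subset_left_of_subset_union hAo hBo hd (image_subset_iff.2 hJW)
    ⟨γ t, mem_image_of_mem γ htJ, ht⟩
  exact mem_map.2 (mem_of_superset hJ fun s hs => hN' (hsub (mem_image_of_mem γ hs)).2)

namespace TranslationSurface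

variable {S : Type*} [TopologicalSpace S] [T2Space S] [CompactSpace S] [ConnectedSpace S]
variable {M : TranslationSurface S} {w : ℂ} {γ : ℝ → S}

theorem Surv.exists_add_pos {x : S} {T : ℝ} (h : M.Surv w x T) : ∃ δ > 0, M.Surv w x (T + δ) := by
  obtain ⟨y, hy⟩ := h
  obtain ⟨ε, hε⟩ := M.exists_isGoodRadius hy.right_notMem
  have hw : 0 < ‖w‖ + 1 := by positivity
  have hδ : 0 < ε / (‖w‖ + 1) := div_pos hε.1 hw
  refine ⟨ε / (‖w‖ + 1), hδ, M.tr y (0 + ((ε / (‖w‖ + 1) : ℝ) : ℂ) * w), hy.trans ?_⟩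
  have := hε.flow (z := 0) (a := ε / (‖w‖ + 1)) (w := w) ?_
  · rwa [tr_zero] at this
  · rw [abs_of_pos hδ, norm_zero, zero_add, div_mul_eq_mul_div, div_lt_iff₀ hw]
    nlinarith [hε.1]

theorem disc_mem_nhds {q : S} {ν : ℝ} (hq : q ∉ M.sing)
    (hν : 0 < ν) : {y | ∃ z : ℂ, ‖z‖ < ν ∧ y = M.tr q z} ∈ 𝓝 q := by
  change ∀ᶠ y in 𝓝 q, ∃ z : ℂ, ‖z‖ < ν ∧ y = M.tr q z
  rw [M.eventually_nhds_iff hq]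
  filter_upwards [Metric.ball_mem_nhds (0 : ℂ) hν] with z hz
  exact ⟨z, by simpa using hz, rfl⟩

/-- A half-trajectory that is not infinite runs into a singularity. -/
theorem exists_hit {x : S} (hx : x ∉ M.sing) (h : ¬ ∀ T, 0 ≤ T → M.Surv w x T) :
    ∃ τ > 0, ∃ γ, M.Traj w γ (Ico 0 τ) ∧ γ 0 = x ∧ ∃ P ∈ M.sing, Tendsto γ (𝓝[<] τ) (𝓝 P) := by
  push Not at h
  obtain ⟨T₀, hT₀⟩ := h
  let A : Set ℝ := {T | 0 ≤ T ∧ ¬ M.Surv w x T}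
  have hbdd : BddBelow A := ⟨0, fun T hT => hT.1⟩
  have hne : A.Nonempty := ⟨T₀, hT₀⟩
  have hτ0 : 0 ≤ sInf A := le_csInf hne fun T hT => hT.1
  have hlt : ∀ T, 0 ≤ T → T < sInf A → M.Surv w x T := fun T h0 hT => by
    by_contra hcon
    exact absurd (csInf_le hbdd ⟨h0, hcon⟩) (not_le.2 hT)
  have hnot : ¬ M.Surv w x (sInf A) := fun hS => by
    obtain ⟨δ, hδ, hS'⟩ := hS.exists_add_pos
    obtain ⟨T, hT, hTlt⟩ := exists_lt_of_csInf_lt hne (lt_add_of_pos_right (sInf A) hδ)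
    exact hT.2 (hS'.mono hT.1 hTlt.le)
  generalize sInf A = τ at hτ0 hlt hnot
  have hτ : 0 < τ := by
    refine hτ0.lt_of_ne fun h0 => hnot ?_
    rw [← h0]; exact ⟨x, Flow.refl hx⟩
  obtain ⟨γ, hγ, rfl⟩ := exists_traj_Ico hτ hlt
  refine ⟨τ, hτ, γ, hγ, rfl, ?_⟩
  refine exists_tendsto_of_mapClusterPt_mem_finite M.finite_sing (fun A hA => ?_) fun q hq => ?_
  · obtain ⟨a, ha, haA⟩ := mem_nhdsLT_iff_exists_Ico_subset.1 hA
    refine ⟨Ico (max a 0) τ, Ico_mem_nhdsLT (max_lt ha hτ), ?_, isPreconnected_Ico, ?_⟩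
    · exact (Ico_subset_Ico_left (le_max_left _ _)).trans haA
    · exact hγ.continuousOn.mono (Ico_subset_Ico_left (le_max_right _ _))
  -- A regular cluster point has a good disc of definite size; entering it shortly before `τ` allows
  -- the flow to continue to time `τ`.
  · by_contra hqs
    obtain ⟨ε, hε⟩ := M.exists_isGoodRadius hqs
    have hε2 := half_pos hε.1
    have h1 := hq.frequently (disc_mem_nhds hqs hε2)
    have h2 : ∀ᶠ t in 𝓝[<] τ, |τ - t| * ‖w‖ < ε / 2 := by
      have : Continuous fun t => |τ - t| * ‖w‖ := by fun_prop
      have := (this.tendsto τ).mono_left (nhdsWithin_le_nhds (s := Iio τ))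
      simp only [sub_self, abs_zero, zero_mul] at this
      exact this.eventually_lt_const hε2
    obtain ⟨t, ⟨⟨z, hz, hzt⟩, ht⟩, ht0⟩ :=
      ((h1.and_eventually h2).and_eventually (Ico_mem_nhdsLT hτ)).exists
    have hf := hε.flow (z := z) (a := τ - t) (w := w) (by linarith)
    rw [← hzt] at hf
    have := (hγ.flow_zero ordConnected_Ico ⟨le_rfl, hτ⟩ ht0).trans hf
    rw [add_sub_cancel] at this
    exact hnot ⟨_, this⟩

theorem Traj.not_surv_of_tendsto {τ : ℝ} (hτ : 0 < τ) (hγ : M.Traj w γ (Ico 0 τ)) {P : S}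
    (hP : P ∈ M.sing) (hlim : Tendsto γ (𝓝[<] τ) (𝓝 P)) : ¬ M.Surv w (γ 0) τ := by
  rintro ⟨y, ρ, hρ, h0, -⟩
  rw [uIcc_of_le hτ.le] at hρ
  have hEq : EqOn γ ρ (Ico 0 τ) := hγ.eqOn (hρ.mono Ico_subset_Icc_self) isPreconnected_Ico
    (left_mem_Ico.2 hτ) h0.symm
  have h1 : Tendsto ρ (𝓝[<] τ) (𝓝 (ρ τ)) :=
    (hρ.continuousOn τ (right_mem_Icc.2 hτ.le)).mono_left
      (nhdsWithin_le_of_mem (mem_of_superset (Ico_mem_nhdsLT hτ) Ico_subset_Icc_self))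
  have h2 : Tendsto ρ (𝓝[<] τ) (𝓝 P) :=
    hlim.congr' (by filter_upwards [Ico_mem_nhdsLT hτ] with t ht using hEq ht)
  have := tendsto_nhds_unique h1 h2
  exact (hρ τ (right_mem_Icc.2 hτ.le)).1 (this ▸ hP)

/-- `φ` is a conical coordinate of angle `2π(k+1)` around `P`. -/
structure IsConeChart (M : TranslationSurface S) (P : S) (k : ℕ) (r : ℝ)
    (φ : OpenPartialHomeomorph S ℂ) : Prop where
  pos : 0 < r
  target : φ.target = Metric.ball 0 r
  mem_source : P ∈ φ.source
  map_zero : φ P = 0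
  inter_sing : φ.source ∩ M.sing = {P}
  tr : ∀ x ∈ φ.source, x ∉ M.sing →
    ∀ᶠ z in 𝓝 (0 : ℂ), φ (M.tr x z) ^ (k + 1) = φ x ^ (k + 1) + z

theorem exists_isConeChart {P : S} (hP : P ∈ M.sing) : ∃ k r φ, M.IsConeChart P k r φ := by
  obtain ⟨k, r, φ, hr, ht, hPs, h0, hi, hc⟩ := M.cone P hP
  refine ⟨k, r, φ, hr, ht, hPs, h0, hi, fun x hx hxs => ?_⟩
  obtain ⟨e, he, hxe, htr⟩ := M.exists_tr_eq hxs
  obtain ⟨c, hc⟩ := hc e he x ⟨hx, hxe⟩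
  filter_upwards [M.tendsto_tr hxs hc, eventually_add_mem_target hxe] with z h1 h2
  rw [mem_preimage, mem_ofPred_eq] at h1
  rw [h1, hc.self_of_nhds, htr, e.right_inv h2]
  ring

namespace IsConeChart

variable {P : S} {k : ℕ} {r : ℝ} {φ : OpenPartialHomeomorph S ℂ}

theorem norm_lt (h : M.IsConeChart P k r φ) {x : S} (hx : x ∈ φ.source) : ‖φ x‖ < r := by
  have := φ.map_source hx
  rw [h.target] at this
  simpa using this

/-- The function `φ ^ (k + 1)` is a local translation coordinate on the punctured cone, so it
advances with velocity `w`. -/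
theorem traj_eq (h : M.IsConeChart P k r φ) {J : Set ℝ} (hγ : M.Traj w γ J)
    (hJ : IsPreconnected J) (hs : ∀ t ∈ J, γ t ∈ φ.source) {a b : ℝ} (ha : a ∈ J) (hb : b ∈ J) :
    φ (γ b) ^ (k + 1) = φ (γ a) ^ (k + 1) + ((b - a : ℝ) : ℂ) * w := by
  refine hJ.induction₂
    (fun a b => φ (γ b) ^ (k + 1) = φ (γ a) ^ (k + 1) + ((b - a : ℝ) : ℂ) * w) ?_ ?_ ?_ ha hb
  · intro a ha
    filter_upwards [(hγ a ha).2, tendsto_sub_mul w a J (h.tr _ (hs a ha) (hγ a ha).1)] with s h1 h2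
    rw [mem_preimage, mem_ofPred_eq] at h2
    rw [h1, h2]
  · intro a b c _ _ _ h1 h2
    rw [h2, h1]; push_cast; ring
  · intro a b _ _ h1
    rw [h1]; push_cast; ring

/-- Letting time tend to `τ` in `traj_eq` fixes the constant, since `φ P = 0`. The remaining time
thus determines `φ` up to a `(k + 1)`-th root. -/
theorem eventually_hit (h : M.IsConeChart P k r φ) {τ : ℝ} (hτ : 0 < τ)
    (hγ : M.Traj w γ (Ico 0 τ)) (hlim : Tendsto γ (𝓝[<] τ) (𝓝 P)) :
    ∀ᶠ s in 𝓝[>] (0 : ℝ), s < τ ∧ γ (τ - s) ∈ φ.source ∧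
      φ (γ (τ - s)) ^ (k + 1) = -((s : ℂ) * w) := by
  obtain ⟨a, ha, hsub⟩ := mem_nhdsLT_iff_exists_Ico_subset.1
    (inter_mem (hlim (φ.open_source.mem_nhds h.mem_source)) (Ico_mem_nhdsLT hτ))
  have hγ' := hγ.mono (hsub.trans inter_subset_right)
  have hγs : ∀ t ∈ Ico a τ, γ t ∈ φ.source := fun t ht => (hsub ht).1
  have haI : a ∈ Ico a τ := left_mem_Ico.2 ha
  have key := fun t (ht : t ∈ Ico a τ) => h.traj_eq hγ' isPreconnected_Ico hγs haI ht
  have h1 : Tendsto (fun t => φ (γ t) ^ (k + 1)) (𝓝[<] τ) (𝓝 (φ P ^ (k + 1))) :=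
    (((φ.continuousAt h.mem_source).tendsto.comp hlim).pow _)
  have h2 : Tendsto (fun t : ℝ => φ (γ a) ^ (k + 1) + ((t - a : ℝ) : ℂ) * w) (𝓝[<] τ)
      (𝓝 (φ (γ a) ^ (k + 1) + ((τ - a : ℝ) : ℂ) * w)) :=
    ((by fun_prop : Continuous fun t : ℝ => φ (γ a) ^ (k + 1) + ((t - a : ℝ) : ℂ) * w).tendsto
      τ).mono_left nhdsWithin_le_nhds
  have h3 := tendsto_nhds_unique h1 (h2.congr' (by
    filter_upwards [Ico_mem_nhdsLT ha] with t ht using (key t ht).symm))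
  rw [h.map_zero, zero_pow (Nat.succ_ne_zero k)] at h3
  filter_upwards [Ioo_mem_nhdsGT (sub_pos.2 ha)] with s hs
  have ht : τ - s ∈ Ico a τ := ⟨by linarith [hs.2], by linarith [hs.1]⟩
  refine ⟨by linarith [hs.2, (hsub haI).2.1], hγs _ ht, ?_⟩
  rw [key _ ht]
  push_cast at h3 ⊢
  linear_combination -h3

end IsConeChart

/-- An infinite half-trajectory accumulates at a regular point. -/
theorem Traj.exists_mapClusterPt (hγ : M.Traj w γ (Ici 0)) (hw : w ≠ 0) :
    ∃ q ∉ M.sing, MapClusterPt q atTop γ := by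
  by_contra! hcon
  obtain ⟨P, hP, hlim⟩ := exists_tendsto_of_mapClusterPt_mem_finite (l := atTop) (γ := γ)
    M.finite_sing (fun A hA => by
      obtain ⟨a, ha⟩ := mem_atTop_sets.1 hA
      exact ⟨Ici (max a 0), Ici_mem_atTop _, fun t ht => ha t ((le_max_left _ _).trans ht),
        isPreconnected_Ici, hγ.continuousOn.mono (Ici_subset_Ici.2 (le_max_right _ _))⟩)
    (fun q hq => by by_contra h; exact hcon q h hq)
  obtain ⟨k, r, φ, h⟩ := M.exists_isConeChart hP
  obtain ⟨a, ha⟩ := mem_atTop_sets.1 (hlim (φ.open_source.mem_nhds h.mem_source))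
  set T := max a 0
  have hγ' := hγ.mono (Ici_subset_Ici.2 (le_max_right a 0))
  have hs : ∀ t ∈ Ici T, γ t ∈ φ.source := fun t ht => ha t ((le_max_left _ _).trans ht)
  have hw' : 0 < ‖w‖ := norm_pos_iff.2 hw
  -- During this time `φ ^ (k + 1)` would move by the full diameter of the open disc of radius `r ^
  -- (k + 1)` that contains it.
  have hb : 0 < 2 * r ^ (k + 1) / ‖w‖ := div_pos (mul_pos two_pos (pow_pos h.pos _)) hw'
  have hT : T + 2 * r ^ (k + 1) / ‖w‖ ∈ Ici T := by simpa using hb.le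
  have key := h.traj_eq hγ' isPreconnected_Ici hs self_mem_Ici hT
  have n1 := fun t ht => pow_lt_pow_left₀ (h.norm_lt (hs t ht)) (norm_nonneg _) (Nat.succ_ne_zero k)
  have h1 := n1 _ hT
  have h2 := n1 _ self_mem_Ici
  rw [← norm_pow] at h1 h2
  have h3 : ‖((T + 2 * r ^ (k + 1) / ‖w‖ - T : ℝ) : ℂ) * w‖ = 2 * r ^ (k + 1) := by
    rw [add_sub_cancel_left, norm_mul, Complex.norm_real, Real.norm_of_nonneg hb.le,
      div_mul_cancel₀ _ hw'.ne']
  rw [← sub_eq_iff_eq_add'] at key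
  have h4 := norm_sub_le (φ (γ (T + 2 * r ^ (k + 1) / ‖w‖)) ^ (k + 1)) (φ (γ T) ^ (k + 1))
  rw [key, h3] at h4
  simp only [Nat.succ_eq_add_one] at h1 h2
  linarith

/-- Only finitely many trajectories run into singularities: among infinitely many,
two have a common end. -/
theorem exists_ne_meet {ι : Type*} [Infinite ι] {τ : ι → ℝ} {γ : ι → ℝ → S}
    {P : ι → S} (hτ : ∀ i, 0 < τ i) (hγ : ∀ i, M.Traj w (γ i) (Ico 0 (τ i)))
    (hP : ∀ i, P i ∈ M.sing) (hlim : ∀ i, Tendsto (γ i) (𝓝[<] (τ i)) (𝓝 (P i))) :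
    ∃ i j, i ≠ j ∧ ∃ s, 0 < s ∧ s < τ i ∧ s < τ j ∧ γ i (τ i - s) = γ j (τ j - s) := by
  classical
  have : Finite M.sing := M.finite_sing
  obtain ⟨⟨Q, hQ⟩, hinf⟩ := Finite.exists_infinite_fiber fun i => (⟨P i, hP i⟩ : M.sing)
  obtain ⟨k, r, φ, h⟩ := M.exists_isConeChart hQ
  -- One more trajectory than there are `(k + 1)`-th roots, for the pigeonhole principle.
  obtain ⟨F, hF⟩ := Infinite.exists_subset_card_eq
    ((fun i => (⟨P i, hP i⟩ : M.sing)) ⁻¹' {⟨Q, hQ⟩}) (k + 2)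
  have hPQ : ∀ i ∈ F, P i = Q := fun i _ => congrArg Subtype.val i.2
  have hev : ∀ᶠ s in 𝓝[>] (0 : ℝ), ∀ i ∈ F, s < τ i ∧ γ i (τ i - s) ∈ φ.source ∧
      φ (γ i (τ i - s)) ^ (k + 1) = -((s : ℂ) * w) := by
    rw [Filter.eventually_all_finset]
    intro i hi
    exact h.eventually_hit (hτ i) (hγ i) (by have := hlim i; rwa [hPQ i hi] at this)
  obtain ⟨s, hs, hs0⟩ := (hev.and self_mem_nhdsWithin).exists
  let R := (Polynomial.nthRoots (k + 1) (-((s : ℂ) * w))).toFinset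
  have hR : R.card < F.card := by
    rw [hF]
    exact ((Multiset.toFinset_card_le _).trans (Polynomial.card_nthRoots _ _)).trans_lt
      (Nat.lt_succ_self _)
  obtain ⟨i, hi, j, hj, hij, he⟩ := Finset.exists_ne_map_eq_of_card_lt_of_maps_to hR
    (f := fun i => φ (γ i (τ i - s))) (fun i hi => by
      refine Finset.mem_coe.2 (Multiset.mem_toFinset.2 ?_)
      exact (Polynomial.mem_nthRoots (Nat.succ_pos k)).2 (hs i hi).2.2)
  exact ⟨i, j, fun hc => hij (Subtype.ext hc), s, hs0, (hs i hi).1, (hs j hj).1,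
    φ.injOn (hs i hi).2.1 (hs j hj).2.1 he⟩

/-- Some trajectory runs into a given singularity. -/
theorem exists_not_surv {P : S} (hP : P ∈ M.sing) (hw : w ≠ 0) :
    ∃ x ∉ M.sing, ∃ τ, 0 ≤ τ ∧ ¬ M.Surv w x τ := by
  obtain ⟨k, r, φ, h⟩ := M.exists_isConeChart hP
  have hw' : 0 < ‖w‖ := norm_pos_iff.2 hw
  have hρ : 0 < r / 2 := half_pos h.pos
  set ρ := r / 2 with hρr
  have hτ : 0 < ρ ^ (k + 1) / ‖w‖ := div_pos (pow_pos hρ _) hw'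
  set τ := ρ ^ (k + 1) / ‖w‖ with hτdef
  have hτw : τ * ‖w‖ = ρ ^ (k + 1) := div_mul_cancel₀ _ hw'.ne'
  -- A starting point whose `(k + 1)`-th power moves straight to `0` in time exactly `τ`.
  obtain ⟨ζ, hζ⟩ := IsAlgClosed.exists_pow_nat_eq (-((τ : ℂ) * w)) (Nat.succ_pos k)
  have hnorm : ‖ζ‖ = ρ := by
    refine (pow_left_inj₀ (norm_nonneg _) hρ.le (Nat.succ_ne_zero k)).1 ?_
    rw [← norm_pow, hζ, norm_neg, norm_mul, Complex.norm_real, Real.norm_of_nonneg hτ.le, hτw]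
  have hball : Metric.closedBall (0 : ℂ) ρ ⊆ φ.target := by
    rw [h.target]; exact Metric.closedBall_subset_ball (half_lt_self h.pos)
  have hζt : ζ ∈ φ.target := hball (by simp [hnorm])
  have hsing : ∀ y ∈ φ.source, y ∈ M.sing ↔ φ y = 0 := fun y hy => by
    have h1 : y ∈ M.sing ↔ y ∈ φ.source ∩ M.sing := by simp [hy]
    rw [h1, h.inter_sing, mem_singleton_iff, ← h.map_zero]
    exact (φ.injOn.eq_iff hy h.mem_source).symm
  refine ⟨φ.symm ζ, ?_, τ, hτ.le, ?_⟩
  · rw [hsing _ (φ.map_target hζt), φ.right_inv hζt, ← norm_eq_zero, hnorm]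
    exact hρ.ne'
  rintro ⟨y, γ, hγ, h0, -⟩
  rw [uIcc_of_le hτ.le] at hγ
  let C : Set S := φ.symm '' Metric.closedBall 0 ρ
  have hC : IsClosed C := ((isCompact_closedBall (0 : ℂ) ρ).image_of_continuousOn
    (φ.continuousOn_symm.mono hball)).isClosed
  have hCs : C ⊆ φ.source := by
    rintro _ ⟨z, hz, rfl⟩; exact φ.map_target (hball hz)
  -- Continuous induction: the formula makes the modulus at most `ρ`, which keeps the curve in the
  -- compact disc `C`, hence in the chart, up to time `τ`.
  let A : Set ℝ := {t | γ t ∈ C ∧ φ (γ t) ^ (k + 1) = ((t - τ : ℝ) : ℂ) * w}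
  have hA : IsClosed (A ∩ Icc 0 τ) := by
    have h1 : IsClosed (Icc 0 τ ∩ γ ⁻¹' C) :=
      hγ.continuousOn.preimage_isClosed_of_isClosed isClosed_Icc hC
    have h2 : ContinuousOn (fun t => φ (γ t) ^ (k + 1) - ((t - τ : ℝ) : ℂ) * w)
        (Icc 0 τ ∩ γ ⁻¹' C) := by
      refine ContinuousOn.sub (ContinuousOn.pow ?_ _) (by fun_prop)
      exact φ.continuousOn.comp (hγ.continuousOn.mono inter_subset_left) fun t ht => hCs ht.2
    have h3 := h2.preimage_isClosed_of_isClosed h1 isClosed_singleton (t := {0})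
    convert h3 using 1
    ext t
    simp only [A, mem_inter_iff, mem_ofPred_eq, mem_preimage, mem_singleton_iff, sub_eq_zero]
    tauto
  have hsub : Icc 0 τ ⊆ A := by
    refine hA.Icc_subset_of_forall_mem_nhdsWithin ⟨?_, ?_⟩ ?_
    · rw [h0]; exact ⟨ζ, by simp [hnorm], rfl⟩
    · rw [h0, φ.right_inv hζt, hζ]; push_cast; ring
    · rintro t ⟨⟨htC, ht⟩, ht0, htτ⟩
      have htI : t ∈ Icc 0 τ := ⟨ht0, htτ.le⟩
      have hle : 𝓝[>] t ≤ 𝓝[Icc 0 τ] t :=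
        nhdsWithin_le_of_mem (mem_of_superset (Ioo_mem_nhdsGT htτ) fun s hs =>
          ⟨ht0.trans hs.1.le, hs.2.le⟩)
      filter_upwards [hle (hγ t htI).2, Ioo_mem_nhdsGT htτ,
        hle (tendsto_sub_mul w t _ (h.tr _ (hCs htC) (hγ t htI).1)),
        hle (hγ.continuousOn t htI (φ.open_source.mem_nhds (hCs htC)))] with s h1 h2 h3 h4
      rw [mem_preimage, mem_ofPred_eq, ← h1, ht] at h3
      have h5 : φ (γ s) ^ (k + 1) = ((s - τ : ℝ) : ℂ) * w := by rw [h3]; push_cast; ring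
      refine ⟨⟨φ (γ s), ?_, φ.left_inv h4⟩, h5⟩
      rw [mem_closedBall_zero_iff]
      refine (pow_le_pow_iff_left₀ (norm_nonneg _) hρ.le (Nat.succ_ne_zero k)).1 ?_
      rw [← norm_pow, h5, norm_mul, Complex.norm_real, ← hτw, Real.norm_eq_abs]
      refine mul_le_mul_of_nonneg_right ?_ hw'.le
      rw [abs_le]
      constructor <;> linarith [h2.1, h2.2]
  obtain ⟨h1, h2⟩ := hsub (right_mem_Icc.2 hτ.le)
  refine (hγ τ (right_mem_Icc.2 hτ.le)).1 ((hsing _ (hCs h1)).2 ?_)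
  simpa using h2

end TranslationSurface

/-! ### Saddle connections, connectedness of the regular part, periodic leaves -/

namespace TranslationSurface

variable {S : Type*} [TopologicalSpace S] [T2Space S] [CompactSpace S] [ConnectedSpace S]
variable {M : TranslationSurface S} {w : ℂ}

/-- Both half-leaves run into singularities; the reversed backward one, followed by the forward one,
is the saddle connection. -/
theorem hasSaddleConnection_of_not_surv {θ : Circle} {p : S} (hp : p ∉ M.sing)
    (h1 : ¬ ∀ T, 0 ≤ T → M.Surv θ p T) (h2 : ¬ ∀ T, 0 ≤ T → M.Surv (-θ) p T) :
    M.HasSaddleConnection θ := by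
  obtain ⟨τ₁, hτ₁, γ₁, hγ₁, h10, P₁, hP₁, hl₁⟩ := exists_hit hp h1
  obtain ⟨τ₂, hτ₂, γ₂, hγ₂, h20, P₂, hP₂, hl₂⟩ := exists_hit hp h2
  have hα := hγ₁.comp_affine 1 (-τ₂)
  have hβ := hγ₂.comp_affine (-1) τ₂
  rw [Complex.ofReal_one, one_mul] at hα
  rw [Complex.ofReal_neg, Complex.ofReal_one, neg_mul_neg, one_mul] at hβ
  have hcα : OrdConnected ((fun t => 1 * t + -τ₂) ⁻¹' Ico 0 τ₁) :=
    ordConnected_Ico.preimage_mono fun p q hpq => by simpa using hpq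
  have hcβ : OrdConnected ((fun t => -1 * t + τ₂) ⁻¹' Ico 0 τ₂) :=
    ordConnected_Ico.preimage_anti fun p q hpq => by linarith
  obtain ⟨η, hη, e1, e2⟩ := hβ.glue hα hcβ hcα (t₀ := τ₂) (by simpa using hτ₂)
    (by simpa using hτ₁) (by simp [h10, h20])
  have hL : 0 < τ₂ + τ₁ := add_pos hτ₂ hτ₁
  have hη' : M.Traj θ η (Ioo 0 (τ₂ + τ₁)) := hη.mono fun t ht => by
    rcases le_total t τ₂ with h | h
    · left; constructor <;> dsimp only <;> linarith [ht.1]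
    · right; constructor <;> dsimp only <;> linarith [ht.2]
  have lim0 : Tendsto η (𝓝[>] 0) (𝓝 P₂) := by
    have h3 : Tendsto (fun t => -1 * t + τ₂) (𝓝[>] 0) (𝓝[<] τ₂) := by
      refine tendsto_nhdsWithin_iff.2 ⟨?_, ?_⟩
      · have : Continuous fun t => -1 * t + τ₂ := by fun_prop
        simpa using (this.tendsto 0).mono_left nhdsWithin_le_nhds
      · filter_upwards [self_mem_nhdsWithin] with t ht
        simpa using ht
    refine (hl₂.comp h3).congr' ?_
    filter_upwards [Ioo_mem_nhdsGT hτ₂] with t ht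
    exact (e1 (by constructor <;> dsimp only <;> linarith [ht.1, ht.2])).symm
  have limL : Tendsto η (𝓝[<] (τ₂ + τ₁)) (𝓝 P₁) := by
    have h3 : Tendsto (fun t => 1 * t + -τ₂) (𝓝[<] (τ₂ + τ₁)) (𝓝[<] τ₁) := by
      refine tendsto_nhdsWithin_iff.2 ⟨?_, ?_⟩
      · have : Continuous fun t => 1 * t + -τ₂ := by fun_prop
        simpa using (this.tendsto (τ₂ + τ₁)).mono_left nhdsWithin_le_nhds
      · filter_upwards [self_mem_nhdsWithin] with t (ht : t < _)
        change 1 * t + -τ₂ < τ₁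
        linarith
    refine (hl₁.comp h3).congr' ?_
    filter_upwards [Ioo_mem_nhdsLT (show τ₂ < τ₂ + τ₁ by linarith)] with t ht
    exact (e2 (by constructor <;> dsimp only <;> linarith [ht.1, ht.2])).symm
  -- The values of `η` at the two ends are arbitrary and are replaced by the limits.
  have hEq : EqOn η (extendFrom (Ioo 0 (τ₂ + τ₁)) η) (Ioo 0 (τ₂ + τ₁)) := fun t ht =>
    (extendFrom_extends hη'.continuousOn t ht).symm
  refine ⟨τ₂ + τ₁, extendFrom (Ioo 0 (τ₂ + τ₁)) η, hL,
    continuousOn_Icc_extendFrom_Ioo hη'.continuousOn lim0 limL, ?_, ?_,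
    (M.isTrajectoryOn_iff _ _ _).2 (hη'.congr hEq)⟩
  · rwa [eq_lim_at_left_extendFrom_Ioo hL lim0]
  · rwa [eq_lim_at_right_extendFrom_Ioo hL limL]

theorem IsConeChart.isPreconnected_punctured {P : S} {k : ℕ} {r : ℝ}
    {φ : OpenPartialHomeomorph S ℂ} (h : M.IsConeChart P k r φ) :
    IsPreconnected (φ.source \ {P}) := by
  have h1 : Metric.ball (0 : ℂ) r \ {0} = Complex.exp '' {z | z.re < Real.log r} := by
    ext z
    simp only [Set.mem_sdiff, mem_ball_zero_iff, mem_singleton_iff, mem_image, mem_ofPred_eq]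
    constructor
    · rintro ⟨hz, hz0⟩
      refine ⟨Complex.log z, ?_, Complex.exp_log hz0⟩
      rw [Complex.log_re]
      exact Real.log_lt_log (norm_pos_iff.2 hz0) hz
    · rintro ⟨y, hy, rfl⟩
      refine ⟨?_, Complex.exp_ne_zero _⟩
      rw [Complex.norm_exp]
      exact (Real.lt_log_iff_exp_lt h.pos).1 hy
  have h2 : IsPreconnected (Metric.ball (0 : ℂ) r \ {0}) := by
    rw [h1]
    exact (convex_halfSpace_re_lt _).isPreconnected.image _ Complex.continuous_exp.continuousOn
  have h3 : φ.source \ {P} = φ.symm '' (Metric.ball (0 : ℂ) r \ {0}) := by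
    rw [← h.target]
    ext x
    constructor
    · rintro ⟨hx, hxP⟩
      exact ⟨φ x, ⟨φ.map_source hx, fun h0 => hxP (φ.injOn hx h.mem_source
        (by rw [mem_singleton_iff.1 h0, h.map_zero]))⟩, φ.left_inv hx⟩
    · rintro ⟨z, ⟨hz, hz0⟩, rfl⟩
      refine ⟨φ.map_target hz, fun hP => hz0 ?_⟩
      rw [mem_singleton_iff, ← φ.right_inv hz, mem_singleton_iff.1 hP, h.map_zero]
  rw [h3]
  exact h2.image _ (φ.continuousOn_symm.mono (by rw [h.target]; exact sdiff_subset))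

theorem frequently_notMem_sing (M : TranslationSurface S) (x : S) : ∃ᶠ y in 𝓝 x, y ∉ M.sing := by
  by_cases hx : x ∈ M.sing
  · obtain ⟨k, r, φ, h⟩ := M.exists_isConeChart hx
    intro hcon
    have h0 : (0 : ℂ) ∈ φ.target := by rw [h.target]; exact Metric.mem_ball_self h.pos
    have h1 : φ.symm 0 = x := by rw [← h.map_zero, φ.left_inv h.mem_source]
    have h2 := (φ.continuousAt_symm h0).tendsto
    rw [h1] at h2
    have h3 : ∀ᶠ z in 𝓝[≠] (0 : ℂ), False := by
      filter_upwards [nhdsWithin_le_nhds (h2 hcon),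
        nhdsWithin_le_nhds (φ.open_target.mem_nhds h0), self_mem_nhdsWithin] with z hz hzt hz0
      have h4 : φ.symm z ∈ φ.source ∩ M.sing := ⟨φ.map_target hzt, not_not.1 hz⟩
      rw [h.inter_sing, mem_singleton_iff] at h4
      apply hz0
      rw [mem_singleton_iff, ← φ.right_inv hzt, h4, h.map_zero]
    exact h3.exists.elim fun _ h => h
  · have : ∀ᶠ y in 𝓝 x, y ∉ M.sing := M.isOpen_compl_sing.mem_nhds hx
    exact this.frequently

/-- A punctured cone neighbourhood is connected, so it lies on one side of any separation of the
regular part; the separation then extends across `Σ`, against connectedness of `S`. -/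
theorem isPreconnected_compl_sing (M : TranslationSurface S) : IsPreconnected M.singᶜ := by
  rw [isPreconnected_iff_subset_of_disjoint]
  intro u v hu hv huv hd
  have hopen : ∀ a : Set S, IsOpen {x | ∀ᶠ y in 𝓝 x, y ∉ M.sing → y ∈ a} := fun a =>
    isOpen_iff_mem_nhds.2 fun x hx => eventually_eventually_nhds.2 hx
  have hcover : (univ : Set S) ⊆
      {x | ∀ᶠ y in 𝓝 x, y ∉ M.sing → y ∈ u} ∪ {x | ∀ᶠ y in 𝓝 x, y ∉ M.sing → y ∈ v} := by
    intro x _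
    by_cases hx : x ∈ M.sing
    · obtain ⟨k, r, φ, h⟩ := M.exists_isConeChart hx
      have hsub : φ.source \ {x} ⊆ M.singᶜ := fun y hy hys => hy.2 (by
        rw [← h.inter_sing]; exact ⟨hy.1, hys⟩)
      have hn : ∀ a : Set S, φ.source \ {x} ⊆ a → ∀ᶠ y in 𝓝 x, y ∉ M.sing → y ∈ a := by
        intro a ha
        filter_upwards [φ.open_source.mem_nhds h.mem_source] with y hy hys
        exact ha ⟨hy, fun hyx => hys (by rw [mem_singleton_iff.1 hyx]; exact hx)⟩
      rcases isPreconnected_iff_subset_of_disjoint.1 h.isPreconnected_punctured u v hu hv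
        (hsub.trans huv) (subset_empty_iff.1 ((inter_subset_inter_left _ hsub).trans hd.subset))
        with h1 | h1
      · exact Or.inl (hn u h1)
      · exact Or.inr (hn v h1)
    · rcases huv hx with h1 | h1
      · exact Or.inl (by filter_upwards [hu.mem_nhds h1] with y hy _ using hy)
      · exact Or.inr (by filter_upwards [hv.mem_nhds h1] with y hy _ using hy)
  have hdisj : (univ : Set S) ∩ ({x | ∀ᶠ y in 𝓝 x, y ∉ M.sing → y ∈ u} ∩
      {x | ∀ᶠ y in 𝓝 x, y ∉ M.sing → y ∈ v}) = ∅ := by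
    rw [eq_empty_iff_forall_notMem]
    rintro x ⟨-, h1, h2⟩
    obtain ⟨y, hy, hyu, hyv⟩ :=
      ((M.frequently_notMem_sing x).and_eventually (Filter.Eventually.and h1 h2)).exists
    have : y ∈ M.singᶜ ∩ (u ∩ v) := ⟨hy, hyu hy, hyv hy⟩
    rw [hd] at this
    exact this
  rcases isPreconnected_iff_subset_of_disjoint.1 isPreconnected_univ _ _ (hopen u) (hopen v)
    hcover hdisj with h | h
  · exact Or.inl fun x hx => Eventually.self_of_nhds (h (mem_univ x)) hx
  · exact Or.inr fun x hx => Eventually.self_of_nhds (h (mem_univ x)) hx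

/-- Near `q` the time-`T` map takes `M.tr q z` to `M.tr y z`; these agree for arbitrarily small `z`,
so their limits `q` and `y` agree. -/
theorem Flow.of_frequently_periodic {T : ℝ} {q : S} (hfr : ∃ᶠ y in 𝓝 q, M.Flow w T y y)
    (hS : M.Surv w q T) : M.Flow w T q q := by
  obtain ⟨y, hy⟩ := hS
  rw [M.frequently_nhds_iff hy.left_notMem] at hfr
  have h1 : ∃ᶠ z in 𝓝 (0 : ℂ), M.tr y z = M.tr q z :=
    (hfr.and_eventually hy.eventually_tr).mono fun z hz => hz.2.unique hz.1
  have := tendsto_nhds_unique_of_frequently_eq (M.tendsto_tr hy.right_notMem)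
    (M.tendsto_tr hy.left_notMem) h1
  rwa [this] at hy

theorem Flow.periodic_neg {T : ℝ} {x : S} (h : M.Flow w T x x) : M.Flow (-w) T x x := by
  have := Flow.neg (w := -w) (t := -T) (x := x) (y := x) (by simpa using h.symm)
  simpa using this

theorem Flow.surv_of_periodic {T : ℝ} (hT : 0 < T) {x : S} (h : M.Flow w T x x) {τ : ℝ}
    (hτ : 0 ≤ τ) : M.Surv w x τ := by
  have h1 : ∀ n : ℕ, M.Flow w (n * T) x x := fun n => by
    induction n with
    | zero => simpa using Flow.refl h.left_notMem
    | succ n ih => have := ih.trans h; push_cast; rwa [add_one_mul]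
  obtain ⟨n, hn⟩ := exists_nat_ge (τ / T)
  exact Surv.mono ⟨x, h1 n⟩ hτ ((div_le_iff₀ hT).1 hn)

/-- A periodic leaf forces a saddle connection when there are singularities. -/
theorem hasSaddleConnection_of_periodic {θ : Circle} (hM : M.sing.Nonempty) {p : S} {T : ℝ}
    (hT : 0 < T) (h : M.Flow θ T p p) : M.HasSaddleConnection θ := by
  by_contra hθ
  have hU : IsOpen {x | M.Flow θ T x x} := by
    refine isOpen_iff_mem_nhds.2 fun x (hx : M.Flow θ T x x) => ?_
    exact (M.eventually_nhds_iff hx.left_notMem).2 hx.eventually_tr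
  -- A regular limit of periodic points has an infinite half-leaf in some direction, as there is no
  -- saddle connection; periodicity passes to the limit in that direction.
  have hV : IsOpen {x | x ∉ M.sing ∧ ¬ M.Flow θ T x x} := by
    refine isOpen_iff_mem_nhds.2 fun q hq => ?_
    refine inter_mem (M.isOpen_compl_sing.mem_nhds hq.1) ?_
    by_contra hcon
    have hfr : ∃ᶠ y in 𝓝 q, M.Flow θ T y y := fun hev => hcon hev
    refine hθ (hasSaddleConnection_of_not_surv hq.1 (fun h1 => ?_) fun h1 => ?_)
    · exact hq.2 (Flow.of_frequently_periodic hfr (h1 T hT.le))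
    · have := Flow.of_frequently_periodic (hfr.mono fun y hy => hy.periodic_neg) (h1 T hT.le)
      exact hq.2 (by simpa using this.periodic_neg)
  obtain ⟨P, hP⟩ := hM
  have hw : (θ : ℂ) ≠ 0 := Circle.coe_ne_zero θ
  obtain ⟨x, hx, τ, hτ, hns⟩ := M.exists_not_surv hP hw
  rcases isPreconnected_iff_subset_of_disjoint.1 M.isPreconnected_compl_sing _ _ hU hV
    (fun y hy => (em (M.Flow θ T y y)).imp id fun hn => ⟨hy, hn⟩)
    (eq_empty_iff_forall_notMem.2 fun y hy => hy.2.2.2 hy.2.1) with h1 | h1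
  · exact hns (Flow.surv_of_periodic hT (h1 hx) hτ)
  · exact (h1 h.left_notMem).2 h

end TranslationSurface

/-! ### Gaps of an invariant set and the strips above them -/

namespace TranslationSurface

variable {S : Type*} [TopologicalSpace S] [T2Space S] [CompactSpace S] [ConnectedSpace S]
variable {M : TranslationSurface S} {u v : ℂ} {K : Set S} {σ : ℝ → S} {δ : ℝ}

/-- An infinite strip above an infinite half-leaf of an invariant set `K`, which does not meet `K`,
closes up. -/
theorem exists_periodic_of_strip (hu : ‖u‖ = 1) (hv : ‖v‖ = 1)
    (huv : ∀ z : ℂ, ∃ a b : ℝ, |a| ≤ ‖z‖ ∧ |b| ≤ ‖z‖ ∧ z = a * u + b * v)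
    (hK : ∀ x y t, M.Flow u t x y → x ∈ K → y ∈ K) (hδ : 0 < δ) (hσ : M.Traj v σ (Icc 0 δ))
    (h0 : σ 0 ∈ K) (hgap : ∀ s ∈ Ioc 0 δ, σ s ∉ K)
    (hinf : ∀ s ∈ Icc 0 δ, ∀ T, 0 ≤ T → M.Surv u (σ s) T) :
    ∃ T > 0, M.Flow u T (σ 0) (σ 0) := by
  obtain ⟨γ, hγ, hγ0⟩ := exists_traj_Ici (hinf 0 ⟨le_rfl, hδ.le⟩)
  have hfl : ∀ t, 0 ≤ t → M.Flow u t (σ 0) (γ t) := fun t ht => by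
    rw [← hγ0]; exact hγ.flow_zero ordConnected_Ici self_mem_Ici ht
  have hu0 : u ≠ 0 := by rw [← norm_pos_iff, hu]; exact one_pos
  obtain ⟨q, hq, hcl⟩ := hγ.exists_mapClusterPt hu0
  obtain ⟨ε, hε⟩ := M.exists_isGoodRadius hq
  have hε0 := hε.1
  obtain ⟨ν, hν, hνε, hνδ, hν1⟩ : ∃ ν : ℝ, 0 < ν ∧ 6 * ν < ε ∧ 2 * ν ≤ δ ∧ 2 * ν ≤ 1 := by
    refine ⟨min (ε / 7) (min (δ / 2) (1 / 2)), by positivity, ?_, ?_, ?_⟩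
    · have := min_le_left (ε / 7) (min (δ / 2) (1 / 2)); linarith
    · have := (min_le_right (ε / 7) (min (δ / 2) (1 / 2))).trans (min_le_left _ _); linarith
    · have := (min_le_right (ε / 7) (min (δ / 2) (1 / 2))).trans (min_le_right _ _); linarith
  have hfr := hcl.frequently (disc_mem_nhds hq hν)
  -- Flowing `σ` for time `T` gives the `v`-segment from `y`, so `y'` is the image of `σ b`;
  -- invariance would put `σ b` in `K`.
  have hclose : ∀ T y y' b, 0 ≤ T → M.Flow u T (σ 0) y → M.Flow v b y y' → y' ∈ K → 0 < b →
      b ≤ δ → False := by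
    rintro T y y' b hT hy ⟨ρ, hρ, rfl, rfl⟩ hyK hb hbδ
    rw [uIcc_of_le hb.le] at hρ
    have hsub : Icc 0 b ⊆ Icc 0 δ := Icc_subset_Icc_right hbδ
    have h1 : ∀ s ∈ Icc 0 b, ∃ y, M.Flow u T (σ s) y := fun s hs => hinf s (hsub hs) T hT
    choose! η hη using h1
    have hb0 : (0 : ℝ) ∈ Icc 0 b := ⟨le_rfl, hb.le⟩
    have hbb : b ∈ Icc 0 b := ⟨hb.le, le_rfl⟩
    have h2 := ((hσ.mono hsub).flow_image hη).eqOn hρ isPreconnected_Icc hb0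
      ((hη 0 hb0).unique hy) hbb
    have h3 := (hη b hbb).symm
    rw [h2] at h3
    exact hgap b ⟨hb, hbδ⟩ (hK _ _ _ h3 hyK)
  have hγK : ∀ t, 0 ≤ t → γ t ∈ K := fun t ht => hK _ _ _ (hfl t ht) h0
  obtain ⟨t₁, ⟨z₁, hz₁, e₁⟩, ht₁⟩ := (hfr.and_eventually (eventually_ge_atTop 1)).exists
  obtain ⟨t₂, ⟨z₂, hz₂, e₂⟩, ht₂⟩ := (hfr.and_eventually (eventually_ge_atTop (t₁ + 2))).exists
  -- Sliding the first return by `a` along the flow aligns it transversally with the second, at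
  -- offset `b`. If `b ≠ 0`, one return lies in the strip above the other. If `b = 0` the leaf
  -- closes up, with positive period because the returns are at least `2` apart and `|a| < 1`.
  obtain ⟨a, b, ha, hb, hab⟩ := huv (z₂ - z₁)
  have hz : ‖z₂ - z₁‖ < 2 * ν := by linarith [norm_sub_le z₂ z₁]
  have haν := ha.trans_lt hz
  have hbν := hb.trans_lt hz
  have ha' := abs_lt.1 haν
  have f1 : M.Flow u a (γ t₁) (M.tr q (z₁ + a * u)) := by
    rw [e₁]; refine hε.flow ?_; rw [hu]; linarith
  have hy := (hfl t₁ (by linarith)).trans f1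
  have hz2 : z₁ + a * u + b * v = z₂ := by linear_combination -hab
  have f2 : M.Flow v b (M.tr q (z₁ + a * u)) (γ t₂) := by
    rw [e₂, ← hz2]; refine hε.flow ?_
    have : ‖z₁ + a * u‖ ≤ ‖z₁‖ + |a| := by
      refine (norm_add_le _ _).trans ?_
      rw [norm_mul, hu, mul_one, Complex.norm_real, Real.norm_eq_abs]
    rw [hv]; linarith
  rcases lt_trichotomy b 0 with hb0 | rfl | hb0
  · exact (hclose t₂ _ _ (-b) (by linarith) (hfl t₂ (by linarith)) f2.symm
      (hK _ _ _ f1 (hγK _ (by linarith))) (by linarith) (by linarith [(abs_lt.1 hbν).1])).elim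
  · have h3 : M.tr q (z₁ + a * u) = γ t₂ := f2.unique (Flow.refl f2.left_notMem) |>.symm
    rw [h3] at hy
    refine ⟨t₂ - (t₁ + a), by linarith, ?_⟩
    exact (hfl t₂ (by linarith)).of_right hy
  · exact (hclose (t₁ + a) _ _ b (by linarith) hy f2 (hγK _ (by linarith)) hb0
      (by linarith [(abs_lt.1 hbν).2])).elim

/-- The first transversal parameter at which a trajectory of length at most `T` hits `Σ`. -/
theorem exists_record (hσ : M.Traj v σ (Icc 0 δ))
    (hinf : ∀ T, 0 ≤ T → M.Surv u (σ 0) T) {s₁ T : ℝ} (hs₁ : s₁ ∈ Icc 0 δ) (hT : 0 ≤ T)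
    (hbad : ¬ M.Surv u (σ s₁) T) :
    ∃ s ∈ Ioc 0 s₁, ∃ τ > 0, ∃ γ, M.Traj u γ (Ico 0 τ) ∧ γ 0 = σ s ∧
      ∃ P ∈ M.sing, Tendsto γ (𝓝[<] τ) (𝓝 P) ∧ ∀ s' ∈ Ico 0 s, M.Surv u (σ s') τ := by
  have hsub : Icc 0 s₁ ⊆ Icc 0 δ := Icc_subset_Icc_right hs₁.2
  have hcl : IsClosed (Icc 0 s₁ ∩ σ ⁻¹' {x | M.Surv u x T}ᶜ) :=
    (hσ.continuousOn.mono hsub).preimage_isClosed_of_isClosed isClosed_Icc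
      (M.isOpen_surv u T).isClosed_compl
  have hcpt := isCompact_Icc.of_isClosed_subset hcl inter_subset_left
  obtain ⟨s, ⟨hs, hsbad⟩, hmin⟩ := hcpt.exists_isLeast ⟨s₁, ⟨hs₁.1, le_rfl⟩, hbad⟩
  have hs0 : 0 < s := hs.1.lt_of_ne fun h => hsbad (by rw [← h]; exact hinf T hT)
  obtain ⟨τ, hτ, γ, hγ, hγ0, P, hP, hlim⟩ := exists_hit (hσ s (hsub hs)).1
    (fun h => hsbad (h T hT))
  refine ⟨s, ⟨hs0, hs.2⟩, τ, hτ, γ, hγ, hγ0, P, hP, hlim, fun s' hs' => ?_⟩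
  -- Heights below the least bad one survive to `T`, so it suffices that the hit occurs by then.
  have hτT : τ ≤ T := by
    by_contra hcon
    refine hsbad ⟨γ T, ?_⟩
    rw [← hγ0]
    exact hγ.flow_zero ordConnected_Ico ⟨le_rfl, hτ⟩ ⟨hT, not_le.1 hcon⟩
  refine Surv.mono (T := T) ?_ hτ.le hτT
  by_contra hcon
  exact absurd (hmin ⟨⟨hs'.1, hs'.2.le.trans hs.2⟩, hcon⟩) (not_le.2 hs'.2)

/-- The strip above an infinite half-leaf of an invariant set `K` which does not meet `K`
is infinite, when it is narrow enough. -/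
theorem exists_infinite_strip (hK : ∀ x y t, M.Flow u t x y → x ∈ K → y ∈ K) (hδ : 0 < δ)
    (hσ : M.Traj v σ (Icc 0 δ)) (h0 : σ 0 ∈ K) (hgap : ∀ s ∈ Ioc 0 δ, σ s ∉ K)
    (hinf : ∀ T, 0 ≤ T → M.Surv u (σ 0) T) :
    ∃ h ∈ Ioc 0 δ, ∀ s ∈ Icc 0 h, ∀ T, 0 ≤ T → M.Surv u (σ s) T := by
  by_contra! hcon
  -- Record heights: no lower height has hit `Σ` by the time this one does. They accumulate at `0`,
  -- so there are infinitely many.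
  let R : Set ℝ := {s | s ∈ Ioc 0 δ ∧ ∃ τ > 0, ∃ γ, M.Traj u γ (Ico 0 τ) ∧ γ 0 = σ s ∧
      ∃ P ∈ M.sing, Tendsto γ (𝓝[<] τ) (𝓝 P) ∧ ∀ s' ∈ Ico 0 s, M.Surv u (σ s') τ}
  have hR : ∀ h ∈ Ioc 0 δ, ∃ s ∈ R, s ≤ h := fun h hh => by
    obtain ⟨s₁, hs₁, T, hT, hbad⟩ := hcon h hh
    obtain ⟨s, hs, hrec⟩ := exists_record hσ hinf ⟨hs₁.1, hs₁.2.trans hh.2⟩ hT hbad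
    exact ⟨s, ⟨⟨hs.1, hs.2.trans (hs₁.2.trans hh.2)⟩, hrec⟩, hs.2.trans hs₁.2⟩
  have hRinf : R.Infinite := fun hfin => by
    obtain ⟨s₀, hs₀, -⟩ := hR δ ⟨hδ, le_rfl⟩
    obtain ⟨m, hm, hmin⟩ := hfin.exists_minimal ⟨s₀, hs₀⟩
    obtain ⟨s, hs, hsm⟩ := hR (m / 2) ⟨half_pos hm.1.1, by linarith [hm.1.1, hm.1.2]⟩
    have h1 : s ≤ m := by linarith [hm.1.1]
    linarith [hmin hs h1, hm.1.1]
  have : Infinite R := hRinf.to_subtype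
  choose τ hτ γ hγ hγ0 P hP hlim hbelow using
    fun s : R => s.2.2
  obtain ⟨i, j, hij, c, hc, hci, hcj, hmeet⟩ := exists_ne_meet hτ hγ hP hlim
  wlog hlt : (j : ℝ) < i generalizing i j
  · exact this j i hij.symm hcj hci hmeet.symm
      ((not_lt.1 hlt).lt_of_ne fun h => hij (Subtype.ext h))
  have hi := i.2.1
  have hj := j.2.1
  have hend : ∀ k : R, c < τ k → M.Flow u (τ k - c) (σ k) (γ k (τ k - c)) := fun k hk => by
    rw [← hγ0 k]
    exact (hγ k).flow_zero ordConnected_Ico ⟨le_rfl, hτ k⟩ ⟨by linarith, by linarith⟩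
  have hji : M.Flow u (τ j - τ i) (σ j) (σ i) := by
    have := (hend j hcj).of_right (hmeet ▸ hend i hci)
    rwa [show τ j - c - (τ i - c) = τ j - τ i by ring] at this
  -- The lower height `j` survives past the hitting time of the record `i`.
  have hτij : τ i < τ j := by
    by_contra hcon
    have h1 := (hbelow i j ⟨hj.1.le, hlt⟩).mono (hτ j).le (not_lt.1 hcon)
    rw [← hγ0 j] at h1
    exact (hγ j).not_surv_of_tendsto (hτ j) (hP j) (hlim j) h1
  have hsv : ∀ s ∈ Icc 0 (j : ℝ), ∃ y, M.Flow u (τ j - τ i) (σ s) y := fun s hs => by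
    rcases hs.2.eq_or_lt with rfl | hsj
    · exact ⟨_, hji⟩
    · exact (hbelow j s ⟨hs.1, hsj⟩).mono (by linarith) (by linarith [hτ i])
  choose! η hη using hsv
  have hsub : Icc 0 (j : ℝ) ⊆ Icc 0 δ := Icc_subset_Icc_right hj.2
  have t1 := (hσ.mono hsub).flow_image hη
  have t2 := hσ.comp_affine 1 (i - j)
  rw [Complex.ofReal_one, one_mul] at t2
  have t3 := t2.mono (J' := Icc 0 (j : ℝ)) fun s hs => by
    constructor <;> dsimp only <;> linarith [hs.1, hs.2, hi.2]
  have hj0 : (0 : ℝ) ∈ Icc 0 (j : ℝ) := ⟨le_rfl, hj.1.le⟩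
  have hjj : (j : ℝ) ∈ Icc 0 (j : ℝ) := ⟨hj.1.le, le_rfl⟩
  -- The flowed segment and the segment shifted by `i - j` are straight and agree at `j`, so `σ 0`
  -- is carried to `σ (i - j)`, a point of the gap.
  have h2 := t1.eqOn t3 isPreconnected_Icc hjj
    (by rw [(hη _ hjj).unique hji, one_mul, add_sub_cancel]) hj0
  have h3 := hη 0 hj0
  rw [h2] at h3
  have h4 := hK _ _ _ h3 h0
  simp only [mul_zero, zero_add] at h4
  exact hgap _ ⟨by linarith, by linarith [hj.1, hi.2]⟩ h4

theorem exists_periodic_of_gap (hu : ‖u‖ = 1) (hv : ‖v‖ = 1)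
    (huv : ∀ z : ℂ, ∃ a b : ℝ, |a| ≤ ‖z‖ ∧ |b| ≤ ‖z‖ ∧ z = a * u + b * v)
    (hK : ∀ x y t, M.Flow u t x y → x ∈ K → y ∈ K) (hδ : 0 < δ) (hσ : M.Traj v σ (Icc 0 δ))
    (h0 : σ 0 ∈ K) (hgap : ∀ s ∈ Ioc 0 δ, σ s ∉ K)
    (hinf : ∀ T, 0 ≤ T → M.Surv u (σ 0) T) : ∃ T > 0, M.Flow u T (σ 0) (σ 0) := by
  obtain ⟨h, hh, hS⟩ := exists_infinite_strip hK hδ hσ h0 hgap hinf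
  exact exists_periodic_of_strip hu hv huv hK hh.1 (hσ.mono (Icc_subset_Icc_right hh.2)) h0
    (fun s hs => hgap s ⟨hs.1, hs.2.trans hh.2⟩) hS

/-- On a segment transverse to the flow through a boundary point of an invariant closed set `K`
there is a point of `K` which bounds an interval of the complement. -/
theorem exists_gap (huv : ∀ z : ℂ, ∃ a b : ℝ, |a| ≤ ‖z‖ ∧ |b| ≤ ‖z‖ ∧ z = a * u + b * v)
    (hu : ‖u‖ = 1) (hv : ‖v‖ = 1) (hKc : IsClosed K)
    (hK : ∀ x y t, M.Flow u t x y → x ∈ K → y ∈ K) {p : S} (hp : p ∉ M.sing) (hpK : p ∈ K)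
    (hfr : ∃ᶠ y in 𝓝 p, y ∉ K) :
    ∃ v', (v' = v ∨ v' = -v) ∧ ∃ σ : ℝ → S, ∃ δ > 0, M.Traj v' σ (Icc 0 δ) ∧ σ 0 ∈ K ∧
      ∀ s ∈ Ioc 0 δ, σ s ∉ K := by
  obtain ⟨ε, hε⟩ := M.exists_isGoodRadius hp
  rw [M.frequently_nhds_iff hp] at hfr
  obtain ⟨z, hzK, hz⟩ := (hfr.and_eventually
    (Metric.ball_mem_nhds (0 : ℂ) (show 0 < ε / 2 by linarith [hε.1]))).exists
  replace hz : ‖z‖ < ε / 2 := by simpa using hz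
  obtain ⟨a, b, ha, hb, rfl⟩ := huv z
  have hbv : ‖(b : ℂ) * v‖ = |b| := by rw [norm_mul, hv, mul_one, Complex.norm_real]; rfl
  -- The flow component of `z` can be dropped because `K` is invariant.
  have hbK : M.tr p (b * v) ∉ K := fun hcon => by
    have := hε.flow (z := b * v) (a := a) (w := u) (by rw [hu, hbv]; linarith)
    rw [add_comm] at this
    exact hzK (hK _ _ _ this hcon)
  obtain ⟨v', hv', c, hc, hcv, hc0⟩ : ∃ v', (v' = v ∨ v' = -v) ∧ ∃ c : ℝ, c < ε ∧
      (c : ℂ) * v' = b * v ∧ 0 ≤ c := by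
    rcases le_total 0 b with h | h
    · exact ⟨v, Or.inl rfl, b, by linarith [le_abs_self b], rfl, h⟩
    · exact ⟨-v, Or.inr rfl, -b, by linarith [neg_le_abs b], by push_cast; ring, by linarith⟩
  have hnv : ‖v'‖ = 1 := by rcases hv' with rfl | rfl <;> simp [hv]
  rw [← hcv] at hbK
  have htr : M.Traj v' (fun s => M.tr p (0 + s * v')) (Icc 0 c) := hε.traj 0 v' fun s hs => by
    rw [zero_add, norm_mul, hnv, mul_one, Complex.norm_real, Real.norm_of_nonneg hs.1]
    linarith [hs.2]
  simp only [zero_add] at htr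
  have hcpt : IsCompact (Icc 0 c ∩ (fun s : ℝ => M.tr p (s * v')) ⁻¹' K) :=
    isCompact_Icc.of_isClosed_subset
      (htr.continuousOn.preimage_isClosed_of_isClosed isClosed_Icc hKc) inter_subset_left
  -- The last point of `K` on the segment from `p` to a point outside `K` bounds the gap.
  obtain ⟨m, ⟨hm, hmK⟩, hmax⟩ := hcpt.exists_isGreatest ⟨0, ⟨le_rfl, hc0⟩, by simpa using hpK⟩
  have hmc : m < c := hm.2.lt_of_ne fun h => hbK (h ▸ hmK)
  have t2 := htr.comp_affine 1 m
  rw [Complex.ofReal_one, one_mul] at t2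
  refine ⟨v', hv', _, c - m, sub_pos.2 hmc, t2.mono fun s hs => ?_, ?_, fun s hs hsK => ?_⟩
  · constructor <;> dsimp only <;> linarith [hs.1, hs.2, hm.1]
  · simpa using hmK
  · have := hmax ⟨⟨by linarith [hs.1, hm.1], by linarith [hs.2]⟩, hsK⟩
    linarith [hs.1]

/-! ### Minimality -/

theorem isMinimalFlow_of_not_hasSaddleConnection (M : TranslationSurface S) (hM : M.sing.Nonempty) (θ : Circle)
    (hθ : ¬ M.HasSaddleConnection θ) : M.IsMinimalFlow θ := by
  intro x hx
  have hxl : x ∈ M.leaf θ x := ⟨0, (M.flowsTo_iff _ _ _ _).2 (Flow.refl hx)⟩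
  have hleaf : ∀ y z t, M.Flow θ t y z → y ∈ M.leaf θ x → z ∈ M.leaf θ x := by
    rintro y z t h ⟨s, hs⟩
    exact ⟨s + t, (M.flowsTo_iff _ _ _ _).2 (((M.flowsTo_iff _ _ _ _).1 hs).trans h)⟩
  have hK : ∀ y z t, M.Flow θ t y z → y ∈ closure (M.leaf θ x) → z ∈ closure (M.leaf θ x) := by
    intro y z t h hy
    rw [mem_closure_iff_frequently, M.frequently_nhds_iff h.left_notMem] at hy
    rw [mem_closure_iff_frequently, M.frequently_nhds_iff h.right_notMem]
    exact (hy.and_eventually h.eventually_tr).mono fun a ha => hleaf _ _ _ ha.2 ha.1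
  have hu : ‖(θ : ℂ)‖ = 1 := Circle.norm_coe θ
  have hcoord : ∀ u v : ℂ, ‖u‖ = 1 → (v = Complex.I * u ∨ v = -(Complex.I * u)) →
      ∀ z : ℂ, ∃ a b : ℝ, |a| ≤ ‖z‖ ∧ |b| ≤ ‖z‖ ∧ z = a * u + b * v := by
    intro u v hu huv z
    have hu0 : u ≠ 0 := by rw [← norm_pos_iff, hu]; exact one_pos
    have hn : ‖z / u‖ = ‖z‖ := by rw [norm_div, hu, div_one]
    have hre := hn ▸ Complex.abs_re_le_norm (z / u)
    have him := hn ▸ Complex.abs_im_le_norm (z / u)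
    have hz : z = ((z / u).re + (z / u).im * Complex.I) * u := by
      rw [Complex.re_add_im, div_mul_cancel₀ _ hu0]
    rcases huv with rfl | rfl
    · exact ⟨_, _, hre, him, by linear_combination hz⟩
    · exact ⟨(z / u).re, -(z / u).im, hre, by rwa [abs_neg], by push_cast; linear_combination hz⟩
  have hint : ∀ p ∉ M.sing, p ∈ closure (M.leaf θ x) → closure (M.leaf θ x) ∈ 𝓝 p := by
    intro p hp hpK
    by_contra hcon
    obtain ⟨v, hv, σ, δ, hδ, hσ, h0, hgap⟩ := exists_gap
      (hcoord θ (Complex.I * θ) hu (Or.inl rfl)) hu (by simp [hu]) isClosed_closure hK hp hpK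
      (fun hev => hcon (by filter_upwards [hev] with y hy using not_not.1 hy))
    have hv1 : ‖v‖ = 1 := by rcases hv with rfl | rfl <;> simp [hu]
    have hσ0 := (hσ 0 ⟨le_rfl, hδ.le⟩).1
    by_cases hf : ∀ T, 0 ≤ T → M.Surv θ (σ 0) T
    · obtain ⟨T, hT, h⟩ := exists_periodic_of_gap hu hv1 (hcoord θ v hu hv) hK hδ hσ h0 hgap hf
      exact hθ (hasSaddleConnection_of_periodic hM hT h)
    by_cases hb : ∀ T, 0 ≤ T → M.Surv (-θ) (σ 0) T
    -- The closure is also invariant under the reversed flow, so the forward argument applies to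
    -- `-θ`.
    · obtain ⟨T, hT, h⟩ := exists_periodic_of_gap (u := -θ) (by rwa [norm_neg]) hv1
        (hcoord (-θ) v (by rwa [norm_neg]) (by rw [mul_neg, neg_neg]; exact hv.symm))
        (fun y z t h => hK y z (-t) h.neg) hδ hσ h0 hgap hb
      exact hθ (hasSaddleConnection_of_periodic hM hT (by simpa using h.periodic_neg))
    · exact hθ (hasSaddleConnection_of_not_surv hσ0 hf hb)
  have hsub : M.singᶜ ⊆ interior (closure (M.leaf θ x)) := by
    rcases isPreconnected_iff_subset_of_disjoint.1 M.isPreconnected_compl_sing _ _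
      (isOpen_interior (s := closure (M.leaf θ x))) isClosed_closure.isOpen_compl
      (fun y hy => (em (y ∈ closure (M.leaf θ x))).imp
        (fun h => mem_interior_iff_mem_nhds.2 (hint y hy h)) id)
      (eq_empty_iff_forall_notMem.2 fun y hy => hy.2.2 (interior_subset hy.2.1)) with h | h
    · exact h
    · exact absurd (subset_closure hxl) (h hx)
  intro y
  rw [← closure_closure, mem_closure_iff_frequently]
  exact (M.frequently_notMem_sing y).mono fun z hz => interior_subset (hsub hz)

end TranslationSurface

theorem mainTheorem5 {S : Type*} [TopologicalSpace S] [T2Space S] [CompactSpace S]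
    [ConnectedSpace S] (M : TranslationSurface S) (hM : M.sing.Nonempty) (θ : Circle)
    (hθ : ¬ M.HasSaddleConnection θ) : M.IsMinimalFlow θ :=
  M.isMinimalFlow_of_not_hasSaddleConnection hM θ hθ
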